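/- Let $n\ge 1$ be an integer. Let $\mathsf{MHS}_n$ be the category of mixed Hodge structures of level $\le n$: the objects are finitely generated abelian groups $H$ with a finite increasing filtration $W$ of $H\otimes\mathbb{Q}$ and a finite decreasing filtration $F$ of $H_{\mathbb C}=H\otimes\mathbb{C}$ such that $F$ induces on each $\mathrm{gr}^W_k$ a pure Hodge structure of weight $k$, and such that all Hodge types $(p,q)$ that occur satisfy $0\le p,q\le n$; the morphisms are the homomorphisms of abelian groups that preserve $W$ and $F$. Let $\mathsf{Vec}_n$ be the category of diagrams $V_n\to V_{n-1}\to\cdots\to V_1$ of finite-dimensional complex vector spaces. Let $\mathsf{FHS}_n$ be the category of formal Hodge structures of level $\le n$: an object $(H,V)$ consists of an object $H_{\rm et}$ of $\mathsf{MHS}_n$, a finite-dimensional complex vector space $H^o$, an object $V=(V_n\to\cdots\to V_1)$ of $\mathsf{Vec}_n$, a homomorphism of abelian groups $h_{\rm et}:H_{\rm et}\to V_n$, a $\mathbb{C}$-linear map $h^o:H^o\to V_n$, and $\mathbb{C}$-linear maps $\pi_i:V_i\to H_{\mathbb C}/F^i$ ($1\le i\le n$, $H_{\mathbb C}=H_{\rm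 et}\otimes\mathbb{C}$), compatible with the maps $V_{i+1}\to V_i$ and the projections $H_{\mathbb C}/F^{i+1}\to H_{\mathbb C}/F^i$, such that $\pi_n\circ h_{\rm et}$ is the canonical map $H_{\rm et}\to H_{\mathbb C}/F^n$. A morphism $(H,V)\to(H',V')$ consists of a morphism $f_{\rm et}:H_{\rm et}\to H'_{\rm et}$ of mixed Hodge structures, a $\mathbb{C}$-linear map $f^o:H^o\to H'^o$ and a morphism $\phi:V\to V'$ of $\mathsf{Vec}_n$ that are compatible with $h_{\rm et}$, $h^o$ and $\pi$. Then the categories $\mathsf{MHS}_n$ and $\mathsf{FHS}_n$ are abelian (as is $\mathsf{Vec}_n$), the embeddings $$\mathsf{MHS}_n\to\mathsf{FHS}_n,\quad H\mapsto (H,\,V_i=H_{\mathbb C}/F^i)\ \text{ with } H^o=0,\ \pi_i=\mathrm{id},\qquad\text{and}\qquad \mathsf{Vec}_n\to\mathsf{FHS}_n,\quad V\mapsto(0,V),$$ are exact, and the functors that they induce on the (unbounded) derived categories, $$D(\mathsf{MHS}_n)\to D(\mathsf{FHS}_n)\qquad\text{and}\qquad D(\mathsf{Vec}_n)\to D(\mathsf{FHS}_n),$$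 are fully faithful. -/

import Mathlib

open CategoryTheory CategoryTheory.Limits
open scoped TensorProduct ComplexConjugate

universe w₁ w₂ w₃ u

namespace FormalHodge

section Conjugation

variable (H : Type u) [AddCommGroup H]

/-- Complex conjugation `z ⊗ x ↦ conj z ⊗ x` on `ℂ ⊗ H`, as a conjugate-linear map. -/
noncomputable def conjC : (ℂ ⊗[ℤ] H) →ₛₗ[starRingEnd ℂ] (ℂ ⊗[ℤ] H) where
  toFun := LinearMap.rTensor H (starRingEnd ℂ).toAddMonoidHom.toIntLinearMap
  map_add' := map_add _
  map_smul' c x := by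
    induction x using TensorProduct.induction_on with
    | zero => simp
    | tmul z y => simp [TensorProduct.smul_tmul', LinearMap.rTensor_tmul]
    | add x y hx hy => rw [smul_add, map_add, hx, hy, map_add, smul_add]

variable {H}

/-- The complex conjugate of a subspace of `ℂ ⊗ H`. -/
noncomputable def conjSub (S : Submodule ℂ (ℂ ⊗[ℤ] H)) : Submodule ℂ (ℂ ⊗[ℤ] H) :=
  S.comap (conjC H)

/-- The canonical map `ℚ ⊗ H → ℂ ⊗ H`. -/
noncomputable def ratToComplex (H : Type u) [AddCommGroup H] : (ℚ ⊗[ℤ] H) →ₗ[ℤ] (ℂ ⊗[ℤ] H) :=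
  LinearMap.rTensor H (algebraMap ℚ ℂ).toAddMonoidHom.toIntLinearMap

/-- The complexification of a rational subspace, as a subspace of `ℂ ⊗ H`. -/
noncomputable def complexify (S : Submodule ℚ (ℚ ⊗[ℤ] H)) : Submodule ℂ (ℂ ⊗[ℤ] H) :=
  Submodule.span ℂ (ratToComplex H '' S)

/-- The complexified graded piece `(W_k / W_{k-1}) ⊗ ℂ` of a filtration `W` of `ℚ ⊗ H`. -/
abbrev GrW (W : ℤ → Submodule ℚ (ℚ ⊗[ℤ] H)) (k : ℤ) : Type u :=
  ↥(complexify (W k)) ⧸ (complexify (W (k - 1))).submoduleOf (complexify (W k))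

/-- The subspace `(S ∩ W_k + W_{k-1}) / W_{k-1}` which a subspace `S` of `ℂ ⊗ H` induces on
the `k`-th graded piece. -/
noncomputable def grSub (W : ℤ → Submodule ℚ (ℚ ⊗[ℤ] H)) (k : ℤ)
    (S : Submodule ℂ (ℂ ⊗[ℤ] H)) : Submodule ℂ (GrW W k) :=
  (S.submoduleOf (complexify (W k))).map (Submodule.mkQ _)

end Conjugation

/-- A mixed Hodge structure: a finitely generated abelian group `H`, a finite increasing
filtration `W` of `ℚ ⊗ H` and a finite decreasing filtration `F` of `ℂ ⊗ H` such that `F` induces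
on the `k`-th graded piece of `W` a pure Hodge structure of weight `k`. -/
structure MHS : Type (u + 1) where
  carrier : Type u
  [addCommGroup : AddCommGroup carrier]
  [finite : Module.Finite ℤ carrier]
  W : ℤ → Submodule ℚ (ℚ ⊗[ℤ] carrier)
  F : ℤ → Submodule ℂ (ℂ ⊗[ℤ] carrier)
  monotone_W : Monotone W
  exists_W_eq_bot : ∃ k, W k = ⊥
  exists_W_eq_top : ∃ k, W k = ⊤
  antitone_F : Antitone F
  exists_F_eq_top : ∃ p, F p = ⊤
  exists_F_eq_bot : ∃ p, F p = ⊥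
  opposed : ∀ k p q : ℤ, p + q = k + 1 →
    IsCompl (grSub W k (F p)) (grSub W k (conjSub (F q)))

namespace MHS

attribute [instance] MHS.addCommGroup MHS.finite

/-- A morphism of mixed Hodge structures: a homomorphism of abelian groups which preserves both
filtrations. -/
@[ext]
structure Hom (H K : MHS.{u}) where
  toLin : H.carrier →ₗ[ℤ] K.carrier
  map_W : ∀ k, H.W k ≤ (K.W k).comap (toLin.baseChange ℚ)
  map_F : ∀ p, H.F p ≤ (K.F p).comap (toLin.baseChange ℂ)

instance : Category.{u} MHS.{u} where
  Hom := Hom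
  id H :=
    { toLin := LinearMap.id
      map_W := fun k => by rw [LinearMap.baseChange_id, Submodule.comap_id]
      map_F := fun p => by rw [LinearMap.baseChange_id, Submodule.comap_id] }
  comp f g :=
    { toLin := g.toLin ∘ₗ f.toLin
      map_W := fun k => by
        rw [LinearMap.baseChange_comp, Submodule.comap_comp]
        exact (f.map_W k).trans (Submodule.comap_mono (g.map_W k))
      map_F := fun p => by
        rw [LinearMap.baseChange_comp, Submodule.comap_comp]
        exact (f.map_F p).trans (Submodule.comap_mono (g.map_F p)) }

@[ext]
theorem hom_ext {H K : MHS.{u}} {f g : H ⟶ K} (h : f.toLin = g.toLin) : f = g :=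
  Hom.ext h

@[simp]
theorem id_toLin (H : MHS.{u}) : Hom.toLin (𝟙 H) = LinearMap.id := rfl

@[simp]
theorem comp_toLin {H K L : MHS.{u}} (f : H ⟶ K) (g : K ⟶ L) :
    Hom.toLin (f ≫ g) = g.toLin ∘ₗ f.toLin := rfl

/-- The Hodge component `H^{p,q}` of the graded piece of weight `p + q`. -/
noncomputable def hodgeComponent (H : MHS.{u}) (p q : ℤ) : Submodule ℂ (GrW H.W (p + q)) :=
  grSub H.W (p + q) (H.F p) ⊓ grSub H.W (p + q) (conjSub (H.F q))

/-- Being of level `≤ n`: the Hodge types `(p, q)` that occur satisfy `0 ≤ p, q ≤ n`. -/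
def levelLE (n : ℕ) : ObjectProperty MHS.{u} := fun H =>
  ∀ p q : ℤ, H.hodgeComponent p q ≠ ⊥ → (0 ≤ p ∧ p ≤ n) ∧ (0 ≤ q ∧ q ≤ n)

end MHS

/-- Mixed Hodge structures of level `≤ n`, a full subcategory of all mixed Hodge structures. -/
abbrev MHSLevel (n : ℕ) : Type (u + 1) := (MHS.levelLE.{u} n).FullSubcategory

/-- Diagrams `V_n → V_{n-1} → ⋯ → V_1` of finite-dimensional complex vector spaces; the object
`V_{n-j}` is the value at `j : Fin n`, so that `V_n` is the value at `0`. -/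
abbrev VecDiag (n : ℕ) : Type (u + 1) := Fin n ⥤ FGModuleCat.{u} ℂ

namespace MHS

/-- The diagram `H_ℂ / F^n → H_ℂ / F^{n-1} → ⋯ → H_ℂ / F^1` of canonical projections. -/
noncomputable def quotF (n : ℕ) (H : MHS.{u}) : VecDiag.{u} n where
  obj j := FGModuleCat.of ℂ ((ℂ ⊗[ℤ] H.carrier) ⧸ H.F ((n : ℤ) - (j : ℕ)))
  map {i j} h := FGModuleCat.ofHom (Submodule.factor (H.antitone_F (by
    have := leOfHom h
    have : (i : ℕ) ≤ (j : ℕ) := this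
    omega)))
  map_id j := by
    refine FGModuleCat.hom_ext (LinearMap.ext fun x => ?_)
    obtain ⟨y, rfl⟩ := Submodule.mkQ_surjective _ x
    rfl
  map_comp f g := by
    refine FGModuleCat.hom_ext (LinearMap.ext fun x => ?_)
    obtain ⟨y, rfl⟩ := Submodule.mkQ_surjective _ x
    rfl

/-- The maps `H_ℂ / F^i → K_ℂ / F^i` induced by a morphism `H → K` of mixed Hodge structures. -/
noncomputable def quotFMap (n : ℕ) {H K : MHS.{u}} (f : H ⟶ K) : H.quotF n ⟶ K.quotF n where
  app j := FGModuleCat.ofHom (Submodule.mapQ _ _ (f.toLin.baseChange ℂ) (f.map_F _))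
  naturality i j g := by
    refine FGModuleCat.hom_ext (LinearMap.ext fun x => ?_)
    obtain ⟨y, rfl⟩ := Submodule.mkQ_surjective _ x
    rfl

theorem quotFMap_id (n : ℕ) (H : MHS.{u}) : quotFMap n (𝟙 H) = 𝟙 (H.quotF n) := by
  refine NatTrans.ext (funext fun j => FGModuleCat.hom_ext (LinearMap.ext fun x => ?_))
  obtain ⟨y, rfl⟩ := Submodule.mkQ_surjective _ x
  change Submodule.mkQ _ ((LinearMap.id (M := H.carrier)).baseChange ℂ y) = Submodule.mkQ _ y
  rw [LinearMap.baseChange_id]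
  rfl

theorem quotFMap_comp (n : ℕ) {H K L : MHS.{u}} (f : H ⟶ K) (g : K ⟶ L) :
    quotFMap n (f ≫ g) = quotFMap n f ≫ quotFMap n g := by
  refine NatTrans.ext (funext fun j => FGModuleCat.hom_ext (LinearMap.ext fun x => ?_))
  obtain ⟨y, rfl⟩ := Submodule.mkQ_surjective _ x
  change Submodule.mkQ _ ((g.toLin ∘ₗ f.toLin).baseChange ℂ y) =
    Submodule.mkQ _ (g.toLin.baseChange ℂ (f.toLin.baseChange ℂ y))
  rw [LinearMap.baseChange_comp]
  rfl

end MHS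

/-- A formal Hodge structure of level `≤ n`. -/
structure FHS (n : ℕ) [NeZero n] : Type (u + 1) where
  /-- the étale part `H_et` -/
  et : MHSLevel.{u} n
  /-- the connected part `H^o` -/
  conn : FGModuleCat.{u} ℂ
  /-- the diagram `V_n → ⋯ → V_1` -/
  V : VecDiag.{u} n
  /-- the étale part `H_et → V_n` of the augmentation, a homomorphism of abelian groups -/
  hEt : et.obj.carrier →ₗ[ℤ] V.obj 0
  /-- the connected part `H^o → V_n` of the augmentation -/
  hConn : conn →ₗ[ℂ] V.obj 0
  /-- the maps `π_i : V_i → H_ℂ / F^i` -/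
  π : V ⟶ et.obj.quotF n
  π_hEt : ∀ x : et.obj.carrier,
    (π.app 0).hom.hom (hEt x) = Submodule.Quotient.mk ((1 : ℂ) ⊗ₜ[ℤ] x)

namespace FHS

variable {n : ℕ} [NeZero n]

/-- A morphism of formal Hodge structures of level `≤ n`. -/
@[ext]
structure Hom (A B : FHS.{u} n) where
  fEt : A.et ⟶ B.et
  fConn : A.conn ⟶ B.conn
  φ : A.V ⟶ B.V
  comm_et : ∀ x : A.et.obj.carrier, (φ.app 0).hom.hom (A.hEt x) = B.hEt (fEt.hom.toLin x)
  comm_conn : ∀ x : A.conn, (φ.app 0).hom.hom (A.hConn x) = B.hConn (fConn.hom.hom x)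
  comm_π : φ ≫ B.π = A.π ≫ MHS.quotFMap n fEt.hom

instance : Category.{u} (FHS.{u} n) where
  Hom := Hom
  id A :=
    { fEt := 𝟙 _
      fConn := 𝟙 _
      φ := 𝟙 _
      comm_et := fun _ => rfl
      comm_conn := fun _ => rfl
      comm_π := by
        rw [ObjectProperty.FullSubcategory.id_hom, MHS.quotFMap_id, Category.id_comp,
          Category.comp_id] }
  comp {A B C} f g :=
    { fEt := f.fEt ≫ g.fEt
      fConn := f.fConn ≫ g.fConn
      φ := f.φ ≫ g.φ
      comm_et := fun x => by
        change (g.φ.app 0).hom.hom ((f.φ.app 0).hom.hom (A.hEt x)) =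
          C.hEt (g.fEt.hom.toLin (f.fEt.hom.toLin x))
        rw [f.comm_et, g.comm_et]
      comm_conn := fun x => by
        change (g.φ.app 0).hom.hom ((f.φ.app 0).hom.hom (A.hConn x)) =
          C.hConn (g.fConn.hom.hom (f.fConn.hom.hom x))
        rw [f.comm_conn, g.comm_conn]
      comm_π := by
        rw [ObjectProperty.FullSubcategory.comp_hom, MHS.quotFMap_comp, Category.assoc, g.comm_π,
          ← Category.assoc, f.comm_π, Category.assoc] }

@[ext]
theorem hom_ext {A B : FHS.{u} n} {f g : A ⟶ B} (h₁ : f.fEt = g.fEt) (h₂ : f.fConn = g.fConn)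
    (h₃ : f.φ = g.φ) : f = g :=
  Hom.ext h₁ h₂ h₃

end FHS

/-- The zero mixed Hodge structure. -/
noncomputable def MHS.zero : MHS.{u} where
  carrier := PUnit
  W _ := ⊤
  F _ := ⊤
  monotone_W _ _ _ := le_rfl
  exists_W_eq_bot := ⟨0, Subsingleton.elim _ _⟩
  exists_W_eq_top := ⟨0, rfl⟩
  antitone_F _ _ _ := le_rfl
  exists_F_eq_top := ⟨0, rfl⟩
  exists_F_eq_bot := ⟨0, Subsingleton.elim _ _⟩
  opposed _ _ _ _ := ⟨fun _ _ _ => (Subsingleton.elim _ _ : _ = ⊥).le,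
    fun _ _ _ => (Subsingleton.elim _ _ : ⊤ = _).le⟩

theorem MHS.levelLE_zero (n : ℕ) : MHS.levelLE.{u} n MHS.zero := by
  intro p q h
  have : Subsingleton (GrW MHS.zero.{u}.W (p + q)) :=
    inferInstanceAs (Subsingleton
      (↥(complexify (H := PUnit.{u + 1}) ⊤) ⧸ (complexify ⊤).submoduleOf (complexify ⊤)))
  exact (h (Subsingleton.elim _ _)).elim

/-- The embedding of mixed Hodge structures of level `≤ n` into formal Hodge structures of level
`≤ n`, sending `H` to `(H, V)` with `H^o = 0`, `V_i = H_ℂ / F^i` and `π_i = id`. -/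
noncomputable def mhsToFHS (n : ℕ) [NeZero n] : MHSLevel.{u} n ⥤ FHS.{u} n where
  obj H :=
    { et := H
      conn := FGModuleCat.of ℂ PUnit
      V := H.obj.quotF n
      hEt := ((H.obj.F _).mkQ.restrictScalars ℤ) ∘ₗ TensorProduct.mk ℤ ℂ H.obj.carrier 1
      hConn := 0
      π := 𝟙 _
      π_hEt := fun _ => rfl }
  map {H K} f :=
    { fEt := f
      fConn := FGModuleCat.ofHom 0
      φ := MHS.quotFMap n f.hom
      comm_et := fun x => by
        change Submodule.mkQ _ (f.hom.toLin.baseChange ℂ (1 ⊗ₜ x)) =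
          Submodule.mkQ _ (1 ⊗ₜ f.hom.toLin x)
        rw [LinearMap.baseChange_tmul]
      comm_conn := fun x => map_zero _
      comm_π := by rw [Category.comp_id, Category.id_comp] }
  map_id H := by
    refine FHS.hom_ext rfl ?_ ?_
    · ext x
    · exact MHS.quotFMap_id n H.obj
  map_comp {H K L} f g := by
    refine FHS.hom_ext rfl ?_ ?_
    · ext x
    · exact MHS.quotFMap_comp n f.hom g.hom

/-- The embedding `V ↦ (0, V)` of diagrams of vector spaces into formal Hodge structures. -/
noncomputable def vecToFHS (n : ℕ) [NeZero n] : VecDiag.{u} n ⥤ FHS.{u} n where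
  obj V :=
    { et := ⟨MHS.zero, MHS.levelLE_zero n⟩
      conn := FGModuleCat.of ℂ PUnit
      V := V
      hEt := 0
      hConn := 0
      π := 0
      π_hEt := fun _ => by
        have : Subsingleton ((ℂ ⊗[ℤ] PUnit.{u + 1}) ⧸ MHS.zero.{u}.F ((n : ℤ) - (0 : Fin n))) :=
          inferInstanceAs (Subsingleton
            ((ℂ ⊗[ℤ] PUnit.{u + 1}) ⧸ (⊤ : Submodule ℂ (ℂ ⊗[ℤ] PUnit.{u + 1}))))
        exact Subsingleton.elim (α := (ℂ ⊗[ℤ] PUnit.{u + 1}) ⧸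
          MHS.zero.{u}.F ((n : ℤ) - (0 : Fin n))) _ _ }
  map {V V'} φ :=
    { fEt := 𝟙 _
      fConn := 𝟙 _
      φ := φ
      comm_et := fun x => map_zero _
      comm_conn := fun x => map_zero _
      comm_π := by rw [Limits.comp_zero, Limits.zero_comp] }
  map_id V := rfl
  map_comp f g := by
    refine FHS.hom_ext ?_ ?_ rfl
    · exact (Category.comp_id _).symm
    · exact (Category.comp_id _).symm

end FormalHodge

/-! The theorem rests on strictness of morphisms of mixed Hodge structures and on a zigzag criterion
for full faithfulness that survives localization.

Strictness. Let G be the complex conjugate of F. For fixed p, the sum of the subspaces G^{m+1-p} ∩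
W_m with m ≤ k is a complement of F^p ∩ W_k in W_k (`exists_mem_sub_mem_oppositeSum`,
`eq_zero_of_mem_oppositeSum`). It is built from W and G alone, so every morphism respects the
decomposition and is therefore strict for F; strictness for W follows by descending induction along
F. Hence kernels and cokernels with the induced filtrations are again mixed Hodge structures,
bijective morphisms are invertible, and MHS_n is abelian. Strictness also makes H ↦ H_ℂ/F^i exact
(`quotFFunctor_exact`), so that kernels and cokernels in FHS_n can be formed componentwise and FHS_n
is abelian too.

Full faithfulness. Let ι have a left inverse E, and let id ← T → ιE be a zigzag of natural
transformations whose left arrow is invertible at every ιX and whose two arrows agree there under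
EιX ≅ X. Naturality along g : ιX → ιY then forces g to be ι of E(g), up to the identifications EιX ≅
X and EιY ≅ Y. If ι, E and T are exact, they and the zigzag act termwise on complexes and descend to
the unbounded derived categories; no resolutions or boundedness enter
(`mapDerivedCategory_full_and_faithful`).

For MHS_n, E is (H,V) ↦ H_et and T discards H^o. The detour through T is needed because π_n ∘ h^o
need not vanish, so (H,V) has in general no evident map to (H_et, H_ℂ/F). For Vec_n, E is Ker π, T
is ιE, and the left arrow is the inclusion (0, Ker π) → (H,V). Exactness of Ker π is a diagram chase
which uses that each π_i is surjective: the image of H_et spans H_ℂ/F^n over ℂ. -/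

namespace FormalHodge

/-! ### Opposed filtrations and strictness -/

section Opposed

variable {R : Type*} [Ring R] {V V' : Type*} [AddCommGroup V] [Module R V] [AddCommGroup V']
  [Module R V']

/-- Three finite filtrations `W`, `F`, `G` (with `W` increasing, `F` and `G` decreasing) such that
`F` and `G` are `k`-opposed on the `k`-th graded piece of `W`, in elementwise form. -/
structure Opposed (W F G : ℤ → Submodule R V) : Prop where
  monotone_W : Monotone W
  exists_W_eq_bot : ∃ k, W k = ⊥
  exists_W_eq_top : ∃ k, W k = ⊤
  antitone_F : Antitone F
  exists_F_eq_top : ∃ p, F p = ⊤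
  exists_F_eq_bot : ∃ p, F p = ⊥
  antitone_G : Antitone G
  exists_G_eq_top : ∃ p, G p = ⊤
  exists_G_eq_bot : ∃ p, G p = ⊥
  exists_sub_mem : ∀ k p q : ℤ, p + q = k + 1 → ∀ x ∈ W k, ∃ a ∈ F p, ∃ b ∈ G q,
    a ∈ W k ∧ b ∈ W k ∧ x - a - b ∈ W (k - 1)
  mem_of_sub_mem : ∀ k p q : ℤ, p + q = k + 1 → ∀ a ∈ F p, ∀ b ∈ G q, a ∈ W k → b ∈ W k →
    a - b ∈ W (k - 1) → a ∈ W (k - 1)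

/-- The sum of the `G^{m+1-p} ∩ W_m` for `m ≤ k`, a functorial complement of `F^p ∩ W_k` in
`W_k`. -/
def oppositeSum (W G : ℤ → Submodule R V) (p k : ℤ) : Submodule R V :=
  ⨆ m : ℤ, ⨆ _ : m ≤ k, G (m + 1 - p) ⊓ W m

theorem le_oppositeSum {W G : ℤ → Submodule R V} {p k m : ℤ} (h : m ≤ k) :
    G (m + 1 - p) ⊓ W m ≤ oppositeSum W G p k :=
  le_iSup₂_of_le (f := fun (m : ℤ) (_ : m ≤ k) => G (m + 1 - p) ⊓ W m) m h le_rfl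

theorem oppositeSum_le {W G : ℤ → Submodule R V} (hW : Monotone W) (p k : ℤ) :
    oppositeSum W G p k ≤ W k :=
  iSup₂_le fun _ h => inf_le_right.trans (hW h)

theorem oppositeSum_mono {W G : ℤ → Submodule R V} {p k l : ℤ} (h : k ≤ l) :
    oppositeSum W G p k ≤ oppositeSum W G p l :=
  iSup₂_le fun _ hm => le_oppositeSum (hm.trans h)

theorem oppositeSum_eq {W G : ℤ → Submodule R V} (p k : ℤ) :
    oppositeSum W G p k = oppositeSum W G p (k - 1) ⊔ (G (k + 1 - p) ⊓ W k) := by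
  refine le_antisymm (iSup₂_le fun m h => ?_)
    (sup_le (oppositeSum_mono (by omega)) (le_oppositeSum le_rfl))
  rcases h.eq_or_lt with rfl | h
  · exact le_sup_right
  · exact le_sup_of_le_left (le_oppositeSum (by omega))

/-- The complement does not involve F; this functoriality is what yields strictness for F. -/
theorem map_mem_oppositeSum {W G : ℤ → Submodule R V} {W' G' : ℤ → Submodule R V'}
    {f : V →ₗ[R] V'} (hW : ∀ k, ∀ x ∈ W k, f x ∈ W' k) (hG : ∀ k, ∀ x ∈ G k, f x ∈ G' k)
    {p k : ℤ} {x : V} (hx : x ∈ oppositeSum W G p k) : f x ∈ oppositeSum W' G' p k := by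
  have : oppositeSum W G p k ≤ (oppositeSum W' G' p k).comap f :=
    iSup₂_le fun m h y hy => le_oppositeSum h ⟨hG _ _ hy.1, hW _ _ hy.2⟩
  exact this hx

namespace Opposed

variable {W F G : ℤ → Submodule R V} {W' F' G' : ℤ → Submodule R V'}

theorem symm (h : Opposed W F G) : Opposed W G F where
  monotone_W := h.monotone_W
  exists_W_eq_bot := h.exists_W_eq_bot
  exists_W_eq_top := h.exists_W_eq_top
  antitone_F := h.antitone_G
  exists_F_eq_top := h.exists_G_eq_top
  exists_F_eq_bot := h.exists_G_eq_bot
  antitone_G := h.antitone_F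
  exists_G_eq_top := h.exists_F_eq_top
  exists_G_eq_bot := h.exists_F_eq_bot
  exists_sub_mem k p q hk x hx := by
    obtain ⟨a, ha, b, hb, hak, hbk, hw⟩ := h.exists_sub_mem k q p (by omega) x hx
    exact ⟨b, hb, a, ha, hbk, hak, by rwa [sub_right_comm]⟩
  mem_of_sub_mem k p q hk a ha b hb hak hbk hab := by
    have hba : b - a ∈ W (k - 1) := neg_sub a b ▸ neg_mem hab
    have := h.mem_of_sub_mem k q p (by omega) b hb a ha hbk hak hba
    simpa using add_mem hab this

/-- Induction on k from the point where W vanishes. The top graded piece contributes a part in F^p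
and a part in G^{k+2-p} ∩ W_{k+1}, which is the new summand m = k + 1; the remainder is one step
lower in W. -/
theorem exists_mem_sub_mem_oppositeSum (h : Opposed W F G) (p k : ℤ) :
    ∀ x ∈ W k, ∃ a ∈ F p, a ∈ W k ∧ x - a ∈ oppositeSum W G p k := by
  obtain ⟨k₀, hk₀⟩ := h.exists_W_eq_bot
  have low : ∀ k ≤ k₀, ∀ x ∈ W k, ∃ a ∈ F p, a ∈ W k ∧ x - a ∈ oppositeSum W G p k := by
    intro k hk x hx
    have : x = 0 := by simpa [hk₀] using h.monotone_W hk hx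
    exact ⟨0, zero_mem _, zero_mem _, by simp [this]⟩
  rcases le_total k k₀ with hk | hk
  · exact low k hk
  induction k, hk using Int.leInduction with
  | base => exact low k₀ le_rfl
  | succ k hk ih =>
    intro x hx
    obtain ⟨a, ha, b, hb, hak, hbk, hw⟩ :=
      h.exists_sub_mem (k + 1) p (k + 1 + 1 - p) (by omega) x hx
    rw [add_sub_cancel_right] at hw
    obtain ⟨a', ha', hak', hc⟩ := ih _ hw
    refine ⟨a + a', add_mem ha ha', add_mem hak (h.monotone_W (by omega) hak'), ?_⟩
    rw [oppositeSum_eq, add_sub_cancel_right]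
    refine Submodule.mem_sup.2 ⟨_, hc, b, ⟨hb, hbk⟩, by abel⟩

/-- Induction on k. If x = c + g with g in the top summand, then x ∈ F^p and g ∈ G^{k+2-p} agree
modulo W_k, so opposedness in weight k + 1 puts both in W_k. As G decreases, g then lies in the
summand m = k, and x lies in the smaller sum. -/
theorem eq_zero_of_mem_oppositeSum (h : Opposed W F G) (p k : ℤ) :
    ∀ x ∈ F p, x ∈ oppositeSum W G p k → x = 0 := by
  obtain ⟨k₀, hk₀⟩ := h.exists_W_eq_bot
  have low : ∀ k ≤ k₀, ∀ x ∈ F p, x ∈ oppositeSum W G p k → x = 0 := by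
    intro k hk x _ hx
    simpa [hk₀] using h.monotone_W hk (oppositeSum_le h.monotone_W _ _ hx)
  rcases le_total k k₀ with hk | hk
  · exact low k hk
  induction k, hk using Int.leInduction with
  | base => exact low k₀ le_rfl
  | succ k hk ih =>
    intro x hxF hx
    have hxW := oppositeSum_le h.monotone_W _ _ hx
    rw [oppositeSum_eq, add_sub_cancel_right] at hx
    obtain ⟨c, hc, g, ⟨hg, hgW⟩, rfl⟩ := Submodule.mem_sup.1 hx
    have hcW := oppositeSum_le h.monotone_W _ _ hc
    have hxk := h.mem_of_sub_mem (k + 1) p (k + 1 + 1 - p) (by omega) _ hxF g hg hxW hgW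
      (by simpa using hcW)
    rw [add_sub_cancel_right] at hxk
    have hgk : g ∈ W k := by simpa using sub_mem hxk hcW
    exact ih _ hxF (add_mem hc
      (le_oppositeSum le_rfl ⟨h.antitone_G (by omega) hg, hgk⟩))

section Strict

variable (h : Opposed W F G) (h' : Opposed W' F' G') {f : V →ₗ[R] V'}
  (hW : ∀ k, ∀ x ∈ W k, f x ∈ W' k) (hF : ∀ k, ∀ x ∈ F k, f x ∈ F' k)
  (hG : ∀ k, ∀ x ∈ G k, f x ∈ G' k)

include h h' hW hF hG

/-- Write x = a + c with a ∈ F^p and c in the opposite sum. Then f c = f x - f a lies in F'^p and in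
the opposite sum of the target, hence vanishes. -/
theorem exists_map_eq_of_mem_F {p k : ℤ} {x : V} (hx : x ∈ W k) (hfx : f x ∈ F' p) :
    ∃ a ∈ F p, a ∈ W k ∧ f a = f x := by
  obtain ⟨a, ha, hak, hc⟩ := h.exists_mem_sub_mem_oppositeSum p k x hx
  refine ⟨a, ha, hak, ?_⟩
  have := h'.eq_zero_of_mem_oppositeSum p k (f (x - a))
    (by rw [map_sub]; exact sub_mem hfx (hF _ _ ha)) (map_mem_oppositeSum hW hG hc)
  rw [map_sub, sub_eq_zero] at this
  exact this.symm

/-- Descending induction on p for x ∈ F^p, starting where F^p = 0. In x = a + b + w with a ∈ F^p and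
b ∈ G^{k+1-p}, opposedness in the target puts f a and f b in W'_{k-1}. The induction hypothesis
handles a, and b is absorbed into the complement of F'^{p-1}. -/
theorem exists_map_eq_of_mem_W_sub_one {k : ℤ} {x : V} (hx : x ∈ W k)
    (hfx : f x ∈ W' (k - 1)) : ∃ w ∈ W (k - 1), f w = f x := by
  obtain ⟨p₁, hp₁⟩ := h.exists_F_eq_bot
  obtain ⟨p₀, hp₀⟩ := h.exists_F_eq_top
  suffices H : ∀ p ≤ p₁, ∀ x ∈ F p, x ∈ W k → f x ∈ W' (k - 1) → ∃ w ∈ W (k - 1), f w = f x from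
    H (min p₀ p₁) (min_le_right _ _) x
      (h.antitone_F (min_le_left _ _) (by rw [hp₀]; trivial)) hx hfx
  clear hfx hx x
  intro p hp
  induction p, hp using Int.leInductionDown with
  | base =>
    intro x hx _ _
    rw [hp₁, Submodule.mem_bot] at hx
    exact ⟨0, zero_mem _, by rw [hx]⟩
  | pred p hp ih =>
    intro x hxF hx hfx
    obtain ⟨a, ha, b, hb, hak, hbk, hw⟩ := h.exists_sub_mem k p (k + 1 - p) (by omega) x hx
    have hfw := hW _ _ hw
    have hfab : f a - (- f b) ∈ W' (k - 1) := by
      have := sub_mem hfx hfw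
      simp only [map_sub] at this
      convert this using 1; abel
    have hfa := h'.mem_of_sub_mem k p (k + 1 - p) (by omega) (f a) (hF _ _ ha) (- f b)
      (neg_mem (hG _ _ hb)) (hW _ _ hak) (neg_mem (hW _ _ hbk)) hfab
    have hfb : f b ∈ W' (k - 1) := by simpa using sub_mem hfab hfa
    obtain ⟨w₁, hw₁, hw₁f⟩ := ih a ha hak hfa
    obtain ⟨a₁, ha₁, ha₁k, hc⟩ := h.exists_mem_sub_mem_oppositeSum (p - 1) (k - 1) _ hw
    have hfc := map_mem_oppositeSum hW hG hc
    -- Lowering p and k together leaves k + 1 - p unchanged, so f b belongs to the summand m = k - 1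
    -- of the opposite sum for p - 1. Hence f (x - a - a₁) = f b + f (w - a₁), with w = x - a - b,
    -- lies both in F'^{p-1} and in its complement.
    have hfb' : f b ∈ oppositeSum W' G' (p - 1) (k - 1) :=
      le_oppositeSum le_rfl ⟨by rw [show k - 1 + 1 - (p - 1) = k + 1 - p by omega]; exact hG _ _ hb, hfb⟩
    have hz := h'.eq_zero_of_mem_oppositeSum (p - 1) (k - 1) (f (x - a - a₁))
      (hF _ _ (sub_mem (sub_mem hxF (h.antitone_F (by omega) ha)) ha₁))
      (by convert add_mem hfb' hfc using 1; rw [← map_add]; congr 1; abel)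
    refine ⟨w₁ + a₁, add_mem hw₁ ha₁k, ?_⟩
    rw [map_sub, map_sub, sub_eq_zero, sub_eq_iff_eq_add] at hz
    rw [map_add, hw₁f, hz, add_comm]

theorem exists_map_eq_of_mem_W {k : ℤ} {x : V} (hfx : f x ∈ W' k) :
    ∃ w ∈ W k, f w = f x := by
  obtain ⟨k₁, hk₁⟩ := h.exists_W_eq_top
  rcases le_total k₁ k with hk | hk
  · exact ⟨x, h.monotone_W hk (by rw [hk₁]; trivial), rfl⟩
  induction k, hk using Int.leInductionDown with
  | base => exact ⟨x, by rw [hk₁]; trivial, rfl⟩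
  | pred k hk ih =>
    obtain ⟨w, hw, hwx⟩ := ih (h'.monotone_W (by omega) hfx)
    rw [← hwx] at hfx ⊢
    exact exists_map_eq_of_mem_W_sub_one h h' hW hF hG hw hfx

theorem exists_map_eq_of_mem_F_of_mem_W {p k : ℤ} {x : V} (hF' : f x ∈ F' p)
    (hW' : f x ∈ W' k) : ∃ a ∈ F p, a ∈ W k ∧ f a = f x := by
  obtain ⟨w, hw, hwx⟩ := exists_map_eq_of_mem_W h h' hW hF hG hW'
  rw [← hwx] at hF' ⊢
  exact exists_map_eq_of_mem_F h h' hW hF hG hw hF'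

/-- An element of the kernel which lies in `W_k` decomposes within the kernel. -/
theorem exists_sub_mem_of_map_eq_zero {k p q : ℤ} (hk : p + q = k + 1) {x : V} (hx : x ∈ W k)
    (hfx : f x = 0) : ∃ a ∈ F p, ∃ b ∈ G q, a ∈ W k ∧ b ∈ W k ∧ x - a - b ∈ W (k - 1) ∧
      f a = 0 ∧ f b = 0 := by
  obtain ⟨a, ha, b, hb, hak, hbk, hw⟩ := h.exists_sub_mem k p q hk x hx
  have hfw := hW _ _ hw
  have hfab : f a - (- f b) ∈ W' (k - 1) := by
    have := neg_mem hfw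
    simp only [map_sub, hfx] at this
    convert this using 1; abel
  have hfa := h'.mem_of_sub_mem k p q hk (f a) (hF _ _ ha) (- f b)
    (neg_mem (hG _ _ hb)) (hW _ _ hak) (neg_mem (hW _ _ hbk)) hfab
  have hfb : f b ∈ W' (k - 1) := by simpa using sub_mem hfab hfa
  -- Strictness corrects a and b by elements of W_{k-1} with the same images, which moves them into
  -- the kernel without changing their graded classes.
  obtain ⟨a₁, ha₁, ha₁k, ha₁f⟩ := exists_map_eq_of_mem_F_of_mem_W h h' hW hF hG (hF _ _ ha) hfa
  obtain ⟨b₁, hb₁, hb₁k, hb₁f⟩ :=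
    exists_map_eq_of_mem_F_of_mem_W h.symm h'.symm hW hG hF (hG _ _ hb) hfb
  refine ⟨a - a₁, sub_mem ha ha₁, b - b₁, sub_mem hb hb₁,
    sub_mem hak (h.monotone_W (by omega) ha₁k), sub_mem hbk (h.monotone_W (by omega) hb₁k), ?_,
    by rw [map_sub, ha₁f, sub_self], by rw [map_sub, hb₁f, sub_self]⟩
  convert add_mem (add_mem hw ha₁k) hb₁k using 1; abel

/-- The images of `F'` and `W'` in the cokernel intersect in the image of `F' ∩ W'`. -/
theorem exists_add_map_eq {p k : ℤ} {y z : V'} {x : V} (hy : y ∈ F' p) (hz : z ∈ W' k)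
    (hyz : y - z = f x) : ∃ a ∈ F' p, a ∈ W' k ∧ ∃ x₁ x₂, a = y + f x₁ ∧ a = z + f x₂ := by
  obtain ⟨a, ha, hak, hc⟩ := h'.exists_mem_sub_mem_oppositeSum p k z hz
  obtain ⟨m, hm⟩ := h.exists_W_eq_top
  obtain ⟨x₁, hx₁, -, hx₂⟩ := h.exists_mem_sub_mem_oppositeSum p (max m k) x
    (h.monotone_W (le_max_left _ _) (by rw [hm]; trivial))
  -- The difference equals (z - a) + f (x - x₁). The maximum of m and k puts both terms in one
  -- opposite sum.
  have key : y - a - f x₁ = 0 := by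
    refine h'.eq_zero_of_mem_oppositeSum p (max m k) _
      (sub_mem (sub_mem hy ha) (hF _ _ hx₁)) ?_
    have := add_mem (oppositeSum_mono (le_max_right m k) hc) (map_mem_oppositeSum hW hG hx₂)
    convert this using 1
    rw [map_sub, ← hyz]; abel
  refine ⟨a, ha, hak, -x₁, x - x₁, ?_, ?_⟩
  · rw [map_neg, ← sub_eq_add_neg, eq_comm, ← sub_eq_zero, ← key]; abel
  · rw [map_sub, ← hyz, eq_comm, ← sub_eq_zero, ← key]; abel

/-- If `a ∈ F'^p ∩ W'_k` and `b ∈ G'^q ∩ W'_k` agree in the cokernel modulo `W'_{k-1}`, and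
`p + q ≤ k + 1`, then they can be changed by elements of the image so as to agree modulo
`W'_{k-1}`. -/
theorem exists_sub_map_sub_mem {k p q : ℤ} (hk : p + q ≤ k + 1) {a b : V'} {x : V}
    (ha : a ∈ F' p) (hb : b ∈ G' q) (hak : a ∈ W' k) (hbk : b ∈ W' k)
    (hab : a - b - f x ∈ W' (k - 1)) :
    ∃ y z : V, a - f y ∈ F' p ∧ b - f z ∈ G' q ∧ a - f y ∈ W' k ∧ b - f z ∈ W' k ∧
      (a - f y) - (b - f z) ∈ W' (k - 1) := by
  -- The discrepancy f x lies in W'_k, so by strictness it comes from W_k. There it splits into an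
  -- F^p-part and a G^{k+1-p}-part modulo W_{k-1}; the latter lies in G^q because q ≤ k + 1 - p.
  obtain ⟨w, hw, hwx⟩ := exists_map_eq_of_mem_W h h' hW hF hG (k := k) (x := x) (by
    have := sub_mem (sub_mem hak hbk) (h'.monotone_W (sub_one_lt k).le hab)
    simpa using this)
  rw [← hwx] at hab
  obtain ⟨y, hy, z, hz, hyk, hzk, hyz⟩ := h.exists_sub_mem k p (k + 1 - p) (by omega) w hw
  refine ⟨y, -z, sub_mem ha (hF _ _ hy), ?_, sub_mem hak (hW _ _ hyk), ?_, ?_⟩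
  · exact sub_mem hb (hG _ _ (neg_mem (h.antitone_G (by omega) hz)))
  · exact sub_mem hbk (hW _ _ (neg_mem hzk))
  · convert add_mem hab (hW _ _ hyz) using 1
    simp only [map_sub, map_neg]; abel

end Strict

end Opposed

end Opposed

end FormalHodge

namespace FormalHodge

/-! ### Rational subspaces and their complexifications -/

section Complexification

variable {H K : Type u} [AddCommGroup H] [AddCommGroup K]

/-- The map `ℂ ⊗ H → ℚ ⊗ H` induced by a `ℚ`-linear form on `ℂ`. -/
noncomputable def ratCoord (H : Type u) [AddCommGroup H] (φ : ℂ →ₗ[ℚ] ℚ) :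
    (ℂ ⊗[ℤ] H) →ₗ[ℤ] (ℚ ⊗[ℤ] H) :=
  LinearMap.rTensor H φ.toAddMonoidHom.toIntLinearMap

@[simp]
theorem ratCoord_tmul (φ : ℂ →ₗ[ℚ] ℚ) (z : ℂ) (x : H) :
    ratCoord H φ (z ⊗ₜ x) = φ z ⊗ₜ x := rfl

@[simp]
theorem ratToComplex_tmul (q : ℚ) (x : H) :
    ratToComplex H (q ⊗ₜ x) = (q : ℂ) ⊗ₜ x := rfl

@[simp]
theorem conjC_tmul (z : ℂ) (x : H) : conjC H (z ⊗ₜ x) = conj z ⊗ₜ x := rfl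

theorem ratCoord_baseChange (φ : ℂ →ₗ[ℚ] ℚ) (f : H →ₗ[ℤ] K) (v : ℂ ⊗[ℤ] H) :
    ratCoord K φ (f.baseChange ℂ v) = f.baseChange ℚ (ratCoord H φ v) := by
  induction v using TensorProduct.induction_on with
  | zero => simp
  | tmul z x => simp
  | add x y hx hy => simp only [map_add, hx, hy]

theorem ratToComplex_baseChange (f : H →ₗ[ℤ] K) (v : ℚ ⊗[ℤ] H) :
    ratToComplex K (f.baseChange ℚ v) = f.baseChange ℂ (ratToComplex H v) := by
  induction v using TensorProduct.induction_on with
  | zero => simp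
  | tmul z x => simp
  | add x y hx hy => simp only [map_add, hx, hy]

theorem conjC_baseChange (f : H →ₗ[ℤ] K) (v : ℂ ⊗[ℤ] H) :
    conjC K (f.baseChange ℂ v) = f.baseChange ℂ (conjC H v) := by
  induction v using TensorProduct.induction_on with
  | zero => simp
  | tmul z x => simp
  | add x y hx hy => simp only [map_add, hx, hy]

@[simp]
theorem conjC_conjC (v : ℂ ⊗[ℤ] H) : conjC H (conjC H v) = v := by
  induction v using TensorProduct.induction_on with
  | zero => simp
  | tmul z x => simp
  | add x y hx hy => simp only [map_add, hx, hy]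

theorem ratCoord_ratToComplex (φ : ℂ →ₗ[ℚ] ℚ) (v : ℚ ⊗[ℤ] H) :
    ratCoord H φ (ratToComplex H v) = φ 1 • v := by
  induction v using TensorProduct.induction_on with
  | zero => simp
  | tmul q x =>
    have : φ (q : ℂ) = φ 1 * q := by
      have := φ.map_smul q 1
      rwa [Rat.smul_one_eq_cast, smul_eq_mul, mul_comm] at this
    simp [TensorProduct.smul_tmul', this]
  | add x y hx hy => simp only [map_add, hx, hy, smul_add]

theorem ratCoord_smul (φ : ℂ →ₗ[ℚ] ℚ) (c : ℂ) (v : ℂ ⊗[ℤ] H) :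
    ratCoord H φ (c • v) = ratCoord H (φ ∘ₗ LinearMap.mulLeft ℚ c) v := by
  induction v using TensorProduct.induction_on with
  | zero => simp
  | tmul z x => simp [TensorProduct.smul_tmul']
  | add x y hx hy => simp only [map_add, hx, hy, smul_add]

/-- Expansion of the complex coefficients in a ℚ-basis of ℂ. Allowing every finite set beyond s lets
two expansions share an index set when vectors are added. -/
theorem exists_eq_sum_smul_ratCoord {ι : Type*} (b : Module.Basis ι ℚ ℂ) (v : ℂ ⊗[ℤ] H) :
    ∃ s : Finset ι, ∀ t, s ⊆ t →
      v = ∑ i ∈ t, b i • ratToComplex H (ratCoord H (b.coord i) v) := by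
  classical
  induction v using TensorProduct.induction_on with
  | zero => exact ⟨∅, by simp⟩
  | tmul z x =>
    refine ⟨(b.repr z).support, fun t ht => ?_⟩
    simp only [ratCoord_tmul, ratToComplex_tmul, TensorProduct.smul_tmul', ← TensorProduct.sum_tmul]
    congr 1
    conv_lhs => rw [← b.linearCombination_repr z]
    rw [Finsupp.linearCombination_apply, Finsupp.sum_of_support_subset _ ht _ (by simp)]
    refine Finset.sum_congr rfl fun i _ => ?_
    rw [Module.Basis.coord_apply, smul_eq_mul, mul_comm, Rat.smul_def]
  | add x y hx hy =>
    obtain ⟨s, hs⟩ := hx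
    obtain ⟨t, ht⟩ := hy
    refine ⟨s ∪ t, fun r hr => ?_⟩
    conv_lhs => rw [hs r (Finset.union_subset_left hr), ht r (Finset.union_subset_right hr)]
    simp only [map_add, smul_add, Finset.sum_add_distrib]

/-- Testing by ℚ-linear forms on ℂ turns the span into a family of membership conditions over ℚ, so
complexification visibly commutes with preimages and intersections. -/
theorem mem_complexify {S : Submodule ℚ (ℚ ⊗[ℤ] H)} {v : ℂ ⊗[ℤ] H} :
    v ∈ complexify S ↔ ∀ φ : ℂ →ₗ[ℚ] ℚ, ratCoord H φ v ∈ S := by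
  constructor
  · intro hv
    induction hv using Submodule.span_induction with
    | mem x hx =>
      obtain ⟨y, hy, rfl⟩ := hx
      intro φ
      rw [ratCoord_ratToComplex]
      exact S.smul_mem _ hy
    | zero => simp
    | add x y _ _ hx hy => intro φ; rw [map_add]; exact add_mem (hx φ) (hy φ)
    | smul c x _ hx => intro φ; rw [ratCoord_smul]; exact hx _
  · intro hv
    obtain ⟨s, hs⟩ := exists_eq_sum_smul_ratCoord (Module.Basis.ofVectorSpace ℚ ℂ) v
    rw [hs s subset_rfl]
    exact sum_mem fun i _ => Submodule.smul_mem _ _ (Submodule.subset_span ⟨_, hv _, rfl⟩)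

theorem ratToComplex_mem_complexify {S : Submodule ℚ (ℚ ⊗[ℤ] H)} {v : ℚ ⊗[ℤ] H} :
    ratToComplex H v ∈ complexify S ↔ v ∈ S := by
  refine ⟨fun h => ?_, fun h => Submodule.subset_span ⟨v, h, rfl⟩⟩
  -- A form with φ 1 ≠ 0 recovers a rational vector up to a nonzero scalar.
  obtain ⟨φ, hφ⟩ := Module.Projective.exists_dual_ne_zero ℚ (one_ne_zero (α := ℂ))
  have := mem_complexify.1 h φ
  rwa [ratCoord_ratToComplex, Submodule.smul_mem_iff _ hφ] at this

theorem complexify_mono {S T : Submodule ℚ (ℚ ⊗[ℤ] H)} (h : S ≤ T) :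
    complexify S ≤ complexify T :=
  Submodule.span_mono (Set.image_mono h)

@[simp]
theorem complexify_bot : complexify (⊥ : Submodule ℚ (ℚ ⊗[ℤ] H)) = ⊥ := by
  simp [complexify]

@[simp]
theorem complexify_top : complexify (⊤ : Submodule ℚ (ℚ ⊗[ℤ] H)) = ⊤ :=
  top_unique fun _ _ => mem_complexify.2 fun _ => trivial

theorem mem_complexify_comap {f : H →ₗ[ℤ] K} {S : Submodule ℚ (ℚ ⊗[ℤ] K)} {v : ℂ ⊗[ℤ] H} :
    v ∈ complexify (S.comap (f.baseChange ℚ)) ↔ f.baseChange ℂ v ∈ complexify S := by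
  simp only [mem_complexify, ratCoord_baseChange, Submodule.mem_comap]

theorem complexify_map (f : H →ₗ[ℤ] K) (S : Submodule ℚ (ℚ ⊗[ℤ] H)) :
    complexify (S.map (f.baseChange ℚ)) = (complexify S).map (f.baseChange ℂ) := by
  rw [complexify, complexify, Submodule.map_span]
  congr 1
  ext v
  constructor
  · rintro ⟨_, ⟨x, hx, rfl⟩, rfl⟩
    exact ⟨_, ⟨x, hx, rfl⟩, (ratToComplex_baseChange f x).symm⟩
  · rintro ⟨_, ⟨x, hx, rfl⟩, rfl⟩
    exact ⟨_, ⟨x, hx, rfl⟩, ratToComplex_baseChange f x⟩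

theorem complexify_inf (S T : Submodule ℚ (ℚ ⊗[ℤ] H)) :
    complexify (S ⊓ T) = complexify S ⊓ complexify T := by
  ext v
  simp only [mem_complexify, Submodule.mem_inf, forall_and]

theorem mem_conjSub {S : Submodule ℂ (ℂ ⊗[ℤ] H)} {v : ℂ ⊗[ℤ] H} :
    v ∈ conjSub S ↔ conjC H v ∈ S := Iff.rfl

theorem mem_conjSub_comap {f : H →ₗ[ℤ] K} {S : Submodule ℂ (ℂ ⊗[ℤ] K)} {v : ℂ ⊗[ℤ] H} :
    v ∈ conjSub (S.comap (f.baseChange ℂ)) ↔ f.baseChange ℂ v ∈ conjSub S := by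
  simp only [mem_conjSub, conjC_baseChange, Submodule.mem_comap]

theorem conjSub_map (f : H →ₗ[ℤ] K) (S : Submodule ℂ (ℂ ⊗[ℤ] H)) :
    conjSub (S.map (f.baseChange ℂ)) = (conjSub S).map (f.baseChange ℂ) := by
  ext v
  constructor
  · rintro ⟨x, hx, hxv⟩
    exact ⟨conjC H x, by simpa [mem_conjSub] using hx, by
      rw [← conjC_baseChange, hxv, conjC_conjC]⟩
  · rintro ⟨x, hx, rfl⟩
    exact ⟨conjC H x, hx, (conjC_baseChange f x).symm⟩

section Graded

variable {W : ℤ → Submodule ℚ (ℚ ⊗[ℤ] H)} {k : ℤ} {F G : Submodule ℂ (ℂ ⊗[ℤ] H)}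

theorem mk_eq_mk {x y : ℂ ⊗[ℤ] H} (hx : x ∈ complexify (W k)) (hy : y ∈ complexify (W k)) :
    (Submodule.Quotient.mk ⟨x, hx⟩ : GrW W k) = Submodule.Quotient.mk ⟨y, hy⟩ ↔
      x - y ∈ complexify (W (k - 1)) :=
  Submodule.Quotient.eq ((complexify (W (k - 1))).submoduleOf (complexify (W k)))

theorem mk_eq_zero {x : ℂ ⊗[ℤ] H} (hx : x ∈ complexify (W k)) :
    (Submodule.Quotient.mk ⟨x, hx⟩ : GrW W k) = 0 ↔ x ∈ complexify (W (k - 1)) :=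
  Submodule.Quotient.mk_eq_zero _

/-- Removes the quotients W_k/W_{k-1}: the two conjuncts are spanning and independence on
representatives, in the form required by `Opposed`. -/
theorem isCompl_grSub_iff :
    IsCompl (grSub W k F) (grSub W k G) ↔
      (∀ x ∈ complexify (W k), ∃ a ∈ F, ∃ b ∈ G, a ∈ complexify (W k) ∧ b ∈ complexify (W k) ∧
        x - a - b ∈ complexify (W (k - 1))) ∧
      (∀ a ∈ F, ∀ b ∈ G, a ∈ complexify (W k) → b ∈ complexify (W k) →
        a - b ∈ complexify (W (k - 1)) → a ∈ complexify (W (k - 1))) := by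
  rw [isCompl_iff, and_comm, codisjoint_iff, Submodule.disjoint_def]
  refine and_congr ⟨fun h x hx => ?_, fun h => top_unique fun x _ => ?_⟩
    ⟨fun h a ha b hb hak hbk hab => ?_, fun h x hxF hxG => ?_⟩
  · have : (Submodule.Quotient.mk ⟨x, hx⟩ : GrW W k) ∈ grSub W k F ⊔ grSub W k G := by
      rw [h]; trivial
    obtain ⟨_, ⟨⟨a, hak⟩, ha, rfl⟩, _, ⟨⟨b, hbk⟩, hb, rfl⟩, hab⟩ := Submodule.mem_sup.1 this
    refine ⟨a, ha, b, hb, hak, hbk, ?_⟩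
    rw [sub_sub]
    exact (mk_eq_mk hx (add_mem hak hbk)).1 hab.symm
  · obtain ⟨⟨x, hx⟩, rfl⟩ := Submodule.Quotient.mk_surjective _ x
    obtain ⟨a, ha, b, hb, hak, hbk, hab⟩ := h x hx
    refine Submodule.mem_sup.2 ⟨_, ⟨⟨a, hak⟩, ha, rfl⟩, _, ⟨⟨b, hbk⟩, hb, rfl⟩, ?_⟩
    rw [sub_sub] at hab
    exact ((mk_eq_mk hx (add_mem hak hbk)).2 hab).symm
  · rw [← mk_eq_zero hak]
    exact h _ ⟨⟨a, hak⟩, ha, rfl⟩ ⟨⟨b, hbk⟩, hb, ((mk_eq_mk hak hbk).2 hab).symm⟩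
  · obtain ⟨⟨a, hak⟩, ha, rfl⟩ := hxF
    obtain ⟨⟨b, hbk⟩, hb, hab⟩ := hxG
    exact (mk_eq_zero hak).2 (h a ha b hb hak hbk ((mk_eq_mk hak hbk).1 hab.symm))

theorem grSub_inf_grSub_ne_bot_iff :
    grSub W k F ⊓ grSub W k G ≠ ⊥ ↔ ∃ a ∈ F, ∃ b ∈ G, a ∈ complexify (W k) ∧
      b ∈ complexify (W k) ∧ a - b ∈ complexify (W (k - 1)) ∧ a ∉ complexify (W (k - 1)) := by
  rw [Submodule.ne_bot_iff]
  constructor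
  · rintro ⟨x, ⟨⟨⟨a, hak⟩, ha, rfl⟩, ⟨⟨b, hbk⟩, hb, hab⟩⟩, h0⟩
    exact ⟨a, ha, b, hb, hak, hbk, (mk_eq_mk hak hbk).1 hab.symm,
      fun h => h0 ((mk_eq_zero hak).2 h)⟩
  · rintro ⟨a, ha, b, hb, hak, hbk, hab, h0⟩
    exact ⟨_, ⟨⟨⟨a, hak⟩, ha, rfl⟩, ⟨⟨b, hbk⟩, hb, ((mk_eq_mk hak hbk).2 hab).symm⟩⟩,
      fun h => h0 ((mk_eq_zero hak).1 h)⟩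

end Graded

end Complexification

namespace MHS

theorem opposedFiltrations (H : MHS.{u}) :
    Opposed (fun k => complexify (H.W k)) H.F (fun q => conjSub (H.F q)) where
  monotone_W _ _ h := complexify_mono (H.monotone_W h)
  exists_W_eq_bot := H.exists_W_eq_bot.imp fun _ h => by rw [h, complexify_bot]
  exists_W_eq_top := H.exists_W_eq_top.imp fun _ h => by rw [h, complexify_top]
  antitone_F := H.antitone_F
  exists_F_eq_top := H.exists_F_eq_top
  exists_F_eq_bot := H.exists_F_eq_bot
  antitone_G _ _ h _ hx := H.antitone_F h hx
  exists_G_eq_top := H.exists_F_eq_top.imp fun _ h => by rw [h]; rfl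
  exists_G_eq_bot := H.exists_F_eq_bot.imp fun _ h => (Submodule.eq_bot_iff _).2 fun x hx => by
    rw [mem_conjSub, h, Submodule.mem_bot] at hx
    rw [← conjC_conjC x, hx, map_zero]
  exists_sub_mem k p q h := (isCompl_grSub_iff.1 (H.opposed k p q h)).1
  mem_of_sub_mem k p q h := (isCompl_grSub_iff.1 (H.opposed k p q h)).2

theorem levelLE_iff {n : ℕ} {H : MHS.{u}} : levelLE n H ↔ ∀ p q : ℤ,
    ∀ a ∈ H.F p, ∀ b ∈ conjSub (H.F q), a ∈ complexify (H.W (p + q)) →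
      b ∈ complexify (H.W (p + q)) → a - b ∈ complexify (H.W (p + q - 1)) →
      a ∉ complexify (H.W (p + q - 1)) → (0 ≤ p ∧ p ≤ n) ∧ (0 ≤ q ∧ q ≤ n) := by
  refine forall₂_congr fun p q => ?_
  rw [hodgeComponent, grSub_inf_grSub_ne_bot_iff]
  constructor
  · exact fun h a ha b hb hak hbk hab h0 => h ⟨a, ha, b, hb, hak, hbk, hab, h0⟩
  · rintro h ⟨a, ha, b, hb, hak, hbk, hab, h0⟩
    exact h a ha b hb hak hbk hab h0

namespace Hom

variable {H K : MHS.{u}} (f : Hom H K)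

theorem mem_W (k : ℤ) : ∀ x ∈ complexify (H.W k), f.toLin.baseChange ℂ x ∈ complexify (K.W k) :=
  fun _ hx => mem_complexify_comap.1 (complexify_mono (f.map_W k) hx)

theorem mem_F (p : ℤ) : ∀ x ∈ H.F p, f.toLin.baseChange ℂ x ∈ K.F p := fun _ hx => f.map_F p hx

theorem mem_conjF (p : ℤ) : ∀ x ∈ conjSub (H.F p), f.toLin.baseChange ℂ x ∈ conjSub (K.F p) :=
  fun _ hx => mem_conjSub_comap.1 (f.map_F p hx)

end Hom

end MHS

end FormalHodge

namespace FormalHodge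

/-! ### Abelian structure and exactness detected by functors to abelian groups -/

section ExactFamilies

universe v' u' t

variable {C : Type u'} [Category.{v'} C] {I : Type t} (G : I → C ⥤ AddCommGrpCat.{u})

/-- A family of additive functors to abelian groups which jointly reflects isomorphisms, such that
`C` has kernels and cokernels which are kernels and cokernels after applying the functors. -/
structure DetectsAbelian [Preadditive C] : Prop where
  isIso_of_bijective {X Y : C} (f : X ⟶ Y) :
    (∀ i, Function.Bijective ((G i).map f).hom) → IsIso f
  exists_kernel {X Y : C} (f : X ⟶ Y) : ∃ (K : C) (k : K ⟶ X) (w : k ≫ f = 0),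
    Nonempty (IsLimit (KernelFork.ofι k w)) ∧ ∀ i, Function.Injective ((G i).map k).hom ∧
      ∀ x, ((G i).map f).hom x = 0 → ∃ y, ((G i).map k).hom y = x
  exists_cokernel {X Y : C} (f : X ⟶ Y) : ∃ (Q : C) (q : Y ⟶ Q) (w : f ≫ q = 0),
    Nonempty (IsColimit (CokernelCofork.ofπ q w)) ∧ ∀ i, Function.Surjective ((G i).map q).hom ∧
      ∀ y, ((G i).map q).hom y = 0 → ∃ x, ((G i).map f).hom x = y

/-- A family of exact functors to abelian groups which jointly reflects isomorphisms. -/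
structure DetectsExact : Prop where
  isIso_of_bijective {X Y : C} (f : X ⟶ Y) :
    (∀ i, Function.Bijective ((G i).map f).hom) → IsIso f
  preservesFiniteLimits (i : I) : PreservesFiniteLimits (G i)
  preservesFiniteColimits (i : I) : PreservesFiniteColimits (G i)

variable {G}

namespace DetectsAbelian

variable [Preadditive C] (hG : DetectsAbelian G)

include hG

theorem hasKernels : HasKernels C where
  has_limit f := by
    obtain ⟨K, k, w, ⟨h⟩, -⟩ := hG.exists_kernel f
    exact ⟨⟨_, h⟩⟩

theorem hasCokernels : HasCokernels C where
  has_colimit f := by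
    obtain ⟨K, k, w, ⟨h⟩, -⟩ := hG.exists_cokernel f
    exact ⟨⟨_, h⟩⟩

variable [∀ i, (G i).Additive]

theorem preservesKernel (i : I) {X Y : C} (f : X ⟶ Y) :
    PreservesLimit (parallelPair f 0) (G i) := by
  obtain ⟨K, k, w, ⟨h⟩, hk⟩ := hG.exists_kernel f
  refine preservesLimit_of_preserves_limit_cone h
    ((KernelFork.isLimitMapConeEquiv _ (G i)).symm ?_)
  let S : ShortComplex AddCommGrpCat := ShortComplex.mk ((G i).map k) ((G i).map f)
    (by rw [← Functor.map_comp, w, Functor.map_zero])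
  have : Mono S.f := (AddCommGrpCat.mono_iff_injective _).2 (hk i).1
  have hS : S.Exact := S.ab_exact_iff.2 (hk i).2
  exact hS.fIsKernel

theorem preservesCokernel (i : I) {X Y : C} (f : X ⟶ Y) :
    PreservesColimit (parallelPair f 0) (G i) := by
  obtain ⟨K, k, w, ⟨h⟩, hk⟩ := hG.exists_cokernel f
  refine preservesColimit_of_preserves_colimit_cocone h
    ((CokernelCofork.isColimitMapCoconeEquiv _ (G i)).symm ?_)
  let S : ShortComplex AddCommGrpCat := ShortComplex.mk ((G i).map f) ((G i).map k)
    (by rw [← Functor.map_comp, w, Functor.map_zero])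
  have : Epi S.g := (AddCommGrpCat.epi_iff_surjective _).2 (hk i).1
  have hS : S.Exact := S.ab_exact_iff.2 (hk i).2
  exact hS.gIsCokernel

/-- The abelian structure of a category in which it is detected by functors to abelian groups. -/
@[reducible]
noncomputable def abelian [HasFiniteProducts C] : Abelian C := by
  have := hG.hasKernels
  have := hG.hasCokernels
  have (X Y : C) (f : X ⟶ Y) : IsIso (Abelian.coimageImageComparison f) := by
    refine hG.isIso_of_bijective _ fun i => ?_
    have hl {X Y : C} (f : X ⟶ Y) := hG.preservesKernel i f
    have hc {X Y : C} (f : X ⟶ Y) := hG.preservesCokernel i f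
    -- Preservation of kernels and cokernels identifies this map with the coimage-image comparison
    -- of G_i f, which is invertible in abelian groups.
    have : IsIso ((G i).map (Abelian.coimageImageComparison f)) := by
      rw [Arrow.isIso_iff_isIso_of_isIso
        (Abelian.PreservesCoimageImageComparison.iso (G i) f).hom]
      infer_instance
    exact ConcreteCategory.bijective_of_isIso ((G i).map (Abelian.coimageImageComparison f))
  exact Abelian.ofCoimageImageComparisonIsIso

theorem detectsExact [HasFiniteProducts C] : DetectsExact G where
  isIso_of_bijective := hG.isIso_of_bijective
  preservesFiniteLimits i := by
    let := hG.abelian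
    have hl {X Y : C} (f : X ⟶ Y) := hG.preservesKernel i f
    exact Functor.preservesFiniteLimits_of_preservesKernels (G i)
  preservesFiniteColimits i := by
    let := hG.abelian
    have hc {X Y : C} (f : X ⟶ Y) := hG.preservesCokernel i f
    exact Functor.preservesFiniteColimits_of_preservesCokernels (G i)

end DetectsAbelian

namespace DetectsExact

variable [Abelian C] (hG : DetectsExact G)

include hG

theorem additive (i : I) : (G i).Additive :=
  have := hG.preservesFiniteLimits i
  Functor.additive_of_preserves_binary_products (G i)

theorem map_comp_eq_zero (S : ShortComplex C) (i : I) (x : (G i).obj S.X₁) :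
    ((G i).map S.g).hom (((G i).map S.f).hom x) = 0 := by
  have := hG.additive i
  have h : (G i).map S.f ≫ (G i).map S.g = 0 := by
    rw [← Functor.map_comp, S.zero, Functor.map_zero]
  exact ConcreteCategory.congr_hom h x

/-- An exact functor commutes with homology, and an object killed by every G_i is zero because its
zero endomorphism is bijective under each of them. -/
theorem exact_iff (S : ShortComplex C) :
    S.Exact ↔ ∀ i, ∀ x, ((G i).map S.g).hom x = 0 → ∃ y, ((G i).map S.f).hom y = x := by
  have := hG.additive
  have := hG.preservesFiniteLimits
  have := hG.preservesFiniteColimits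
  constructor
  · intro hS i
    exact (S.map (G i)).ab_exact_iff.1 (hS.map (G i))
  · intro hS
    rw [ShortComplex.exact_iff_isZero_homology]
    have h0 (i : I) : IsZero ((G i).obj S.homology) := by
      refine IsZero.of_iso ?_ (S.mapHomologyIso (G i)).symm
      rw [← ShortComplex.exact_iff_isZero_homology]
      exact (S.map (G i)).ab_exact_iff.2 (hS i)
    have : IsIso (0 : S.homology ⟶ S.homology) := hG.isIso_of_bijective _ fun i => by
      have := AddCommGrpCat.subsingleton_of_isZero (h0 i)
      exact ⟨Function.injective_of_subsingleton _, fun x => ⟨x, Subsingleton.elim _ _⟩⟩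
    rw [IsZero.iff_id_eq_zero, ← IsIso.hom_inv_id (0 : S.homology ⟶ S.homology), zero_comp]

theorem mono_iff {X Y : C} (f : X ⟶ Y) : Mono f ↔ ∀ i, Function.Injective ((G i).map f).hom := by
  have := hG.preservesFiniteLimits
  have := hG.additive
  refine ⟨fun _ i => (AddCommGrpCat.mono_iff_injective _).1 inferInstance, fun h => ?_⟩
  rw [← ShortComplex.exact_iff_mono (ShortComplex.mk (0 : X ⟶ X) f zero_comp) rfl, hG.exact_iff]
  intro i x hx
  exact ⟨0, by rw [map_zero]; exact (h i (by rw [map_zero]; exact hx)).symm⟩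

theorem epi_iff {X Y : C} (f : X ⟶ Y) : Epi f ↔ ∀ i, Function.Surjective ((G i).map f).hom := by
  have := hG.preservesFiniteColimits
  have := hG.additive
  refine ⟨fun _ i => (AddCommGrpCat.epi_iff_surjective _).1 inferInstance, fun h => ?_⟩
  rw [← ShortComplex.exact_iff_epi (ShortComplex.mk f (0 : Y ⟶ Y) comp_zero) rfl, hG.exact_iff]
  exact fun i x _ => h i x

end DetectsExact

/-- An additive functor which sends short exact sequences to sequences that are exact after
applying a family of functors detecting exactness is exact. -/
theorem preservesFiniteLimits_and_colimits {D : Type*} [Category* D] [Abelian C] [Abelian D]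
    {G : I → D ⥤ AddCommGrpCat.{u}} (hG : DetectsExact G) (F : C ⥤ D) [F.Additive]
    (hf : ∀ S : ShortComplex C, S.ShortExact → ∀ i,
      Function.Injective ((G i).map (F.map S.f)).hom ∧
      (∀ x, ((G i).map (F.map S.g)).hom x = 0 → ∃ y, ((G i).map (F.map S.f)).hom y = x) ∧
      Function.Surjective ((G i).map (F.map S.g)).hom) :
    PreservesFiniteLimits F ∧ PreservesFiniteColimits F := by
  refine (F.exact_tfae.out 0 3).1 fun S hS => ?_
  have : Mono (S.map F).f := (hG.mono_iff _).2 fun i => (hf S hS i).1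
  have : Epi (S.map F).g := (hG.epi_iff _).2 fun i => (hf S hS i).2.2
  exact { exact := (hG.exact_iff _).2 fun i => (hf S hS i).2.1 }

end ExactFamilies

end FormalHodge

namespace FormalHodge

/-! ### The zigzag criterion and its passage to derived categories -/

section FullyFaithful

variable {C₁ C₂ D₁ D₂ : Type*} [Category* C₁] [Category* C₂] [Category* D₁] [Category* D₂]

/-- A functor `ι` is fully faithful if it has a left inverse `E` and there is a zigzag of natural
transformations from the identity to `E ⋙ ι` whose value at the objects `ι X` consists of
isomorphisms compatible with the identification `E (ι X) ≅ X`. -/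
theorem full_and_faithful_of_zigzag {ι : C₁ ⥤ C₂} {E : C₂ ⥤ C₁} {T : C₂ ⥤ C₂}
    (ε : T ⟶ 𝟭 C₂) (η : T ⟶ E ⋙ ι) (α : ι ⋙ E ≅ 𝟭 C₁) (hε : ∀ X, IsIso (ε.app (ι.obj X)))
    (hη : ∀ X, η.app (ι.obj X) ≫ ι.map (α.hom.app X) = ε.app (ι.obj X)) :
    ι.Full ∧ ι.Faithful := by
  refine ⟨⟨fun {X Y} g => ⟨α.inv.app X ≫ E.map g ≫ α.hom.app Y, ?_⟩⟩,
    Functor.Faithful.of_comp_iso α⟩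
  -- Precomposed with the invertible ε at ι X, the morphism g becomes T g followed by ε at ι Y;
  -- there ε can be traded for η, whose naturality produces ι (E g).
  rw [← cancel_epi (ε.app (ι.obj X))]
  have h₁ := ε.naturality g
  have h₂ := η.naturality g
  dsimp at h₁ h₂
  rw [← h₁, ← hη Y, ← Category.assoc (T.map g), h₂, ← hη X]
  have h₃ : ι.map (α.hom.app X) ≫ ι.map (α.inv.app X) = 𝟙 _ := by
    rw [← ι.map_comp, Iso.hom_inv_id_app, ι.map_id]
  simp [reassoc_of% h₃]

section Localization

variable (L₁ : C₁ ⥤ D₁) (W₁ : MorphismProperty C₁) [L₁.IsLocalization W₁]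
  (L₂ : C₂ ⥤ D₂) (W₂ : MorphismProperty C₂) [L₂.IsLocalization W₂]
  {ι : C₁ ⥤ C₂} {E : C₂ ⥤ C₁} {T : C₂ ⥤ C₂}
  {ι' : D₁ ⥤ D₂} {E' : D₂ ⥤ D₁} {T' : D₂ ⥤ D₂}

-- Functors that respect the localizations descend, and so do natural transformations between them.
-- The hypotheses of `full_and_faithful_of_zigzag` need checking only on objects L₁ X, which
-- represent all objects up to isomorphism.
include W₁ W₂ in
theorem full_and_faithful_of_zigzag_of_isLocalization (eι : L₁ ⋙ ι' ≅ ι ⋙ L₂)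
    (eE : L₂ ⋙ E' ≅ E ⋙ L₁) (eT : L₂ ⋙ T' ≅ T ⋙ L₂)
    (ε : T ⟶ 𝟭 C₂) (η : T ⟶ E ⋙ ι) (α : ι ⋙ E ≅ 𝟭 C₁) (hε : ∀ X, IsIso (ε.app (ι.obj X)))
    (hη : ∀ X, η.app (ι.obj X) ≫ ι.map (α.hom.app X) = ε.app (ι.obj X)) :
    ι'.Full ∧ ι'.Faithful := by
  let eEι : L₂ ⋙ E' ⋙ ι' ≅ E ⋙ ι ⋙ L₂ :=
    (Functor.isoWhiskerRight eE ι' : L₂ ⋙ E' ⋙ ι' ≅ E ⋙ L₁ ⋙ ι') ≪≫ Functor.isoWhiskerLeft E eι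
  let eιE : L₁ ⋙ ι' ⋙ E' ≅ ι ⋙ E ⋙ L₁ :=
    (Functor.isoWhiskerRight eι E' : L₁ ⋙ ι' ⋙ E' ≅ ι ⋙ L₂ ⋙ E') ≪≫ Functor.isoWhiskerLeft ι eE
  let : Localization.Lifting L₂ W₂ (T ⋙ L₂) T' := ⟨eT⟩
  let : Localization.Lifting L₂ W₂ (E ⋙ ι ⋙ L₂) (E' ⋙ ι') := ⟨eEι⟩
  let : Localization.Lifting L₁ W₁ (ι ⋙ E ⋙ L₁) (ι' ⋙ E') := ⟨eιE⟩
  let ε' : T' ⟶ 𝟭 D₂ := Localization.liftNatTrans L₂ W₂ (T ⋙ L₂) L₂ T' (𝟭 D₂)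
    (Functor.whiskerRight ε L₂ ≫ L₂.leftUnitor.hom)
  let η' : T' ⟶ E' ⋙ ι' := Localization.liftNatTrans L₂ W₂ (T ⋙ L₂) (E ⋙ ι ⋙ L₂) T' (E' ⋙ ι')
    (Functor.whiskerRight η L₂)
  let α' : ι' ⋙ E' ≅ 𝟭 D₁ := Localization.liftNatIso L₁ W₁ (ι ⋙ E ⋙ L₁) L₁ (ι' ⋙ E') (𝟭 D₁)
    (Functor.isoWhiskerRight α L₁ ≪≫ L₁.leftUnitor)
  have hε' (Y : C₂) : ε'.app (L₂.obj Y) = eT.hom.app Y ≫ L₂.map (ε.app Y) := by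
    have : (Localization.Lifting.iso L₂ W₂ (T ⋙ L₂) T') = eT := rfl
    simp [ε', this]
  have hη' (Y : C₂) : η'.app (L₂.obj Y) ≫ ι'.map (eE.hom.app Y) ≫ eι.hom.app (E.obj Y) =
      eT.hom.app Y ≫ L₂.map (η.app Y) := by
    have h₁ : (Localization.Lifting.iso L₂ W₂ (T ⋙ L₂) T') = eT := rfl
    have h₂ : (Localization.Lifting.iso L₂ W₂ (E ⋙ ι ⋙ L₂) (E' ⋙ ι')) = eEι := rfl
    have h₃ : ι'.map (eE.hom.app Y) ≫ eι.hom.app (E.obj Y) = eEι.hom.app Y := rfl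
    simp [η', h₁, h₂, h₃]
  have hα' (X : C₁) : α'.hom.app (L₁.obj X) =
      E'.map (eι.hom.app X) ≫ eE.hom.app (ι.obj X) ≫ L₁.map (α.hom.app X) := by
    have : (Localization.Lifting.iso L₁ W₁ (ι ⋙ E ⋙ L₁) (ι' ⋙ E')) = eιE := rfl
    simp [α', this, eιE]
  refine full_and_faithful_of_zigzag ε' η' α' (fun X => ?_) (fun X => ?_)
  · have := Localization.essSurj L₁ W₁
    rw [NatTrans.isIso_app_iff_of_iso ε' (ι'.mapIso (L₁.objObjPreimageIso X).symm ≪≫ eι.app _)]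
    change IsIso (ε'.app (L₂.obj _))
    rw [hε']
    have := hε (L₁.objPreimage X)
    infer_instance
  -- Phrased as an equality of natural transformations, the identity can be tested after
  -- precomposition with L₁.
  · let τ₁ : ι' ⋙ T' ⟶ ι' := Functor.whiskerLeft ι' η' ≫ Functor.whiskerRight α'.hom ι'
    let τ₂ : ι' ⋙ T' ⟶ ι' := Functor.whiskerLeft ι' ε'
    suffices τ₁ = τ₂ from NatTrans.congr_app this X
    refine Localization.natTrans_ext L₁ W₁ fun X => ?_
    have n₁ := ε'.naturality (eι.hom.app X)
    have n₂ := η'.naturality (eι.hom.app X)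
    dsimp at n₁ n₂
    change η'.app (ι'.obj (L₁.obj X)) ≫ ι'.map (α'.hom.app (L₁.obj X)) = ε'.app _
    rw [← cancel_mono (eι.hom.app X)]
    refine Eq.trans ?_ n₁
    have n₃ := eι.hom.naturality (α.hom.app X)
    dsimp at n₃
    have hL := congr_arg L₂.map (hη X)
    rw [L₂.map_comp] at hL
    rw [hα', hε', ← hL, ← reassoc_of% (hη' (ι.obj X)), ← n₃, ι'.map_comp, ← reassoc_of% n₂]
    simp

end Localization

section DerivedCategory

variable {ι : C₁ ⥤ C₂} {E : C₂ ⥤ C₁} {T : C₂ ⥤ C₂} [Abelian C₁] [Abelian C₂]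
  [ι.Additive] [PreservesFiniteLimits ι] [PreservesFiniteColimits ι]
  [HasDerivedCategory.{w₁} C₁] [HasDerivedCategory.{w₂} C₂]

/-- The derived category is the localization of complexes at quasi-isomorphisms, and exact functors
preserve these; the whole zigzag is applied degree by degree. -/
theorem mapDerivedCategory_full_and_faithful
    (hE : PreservesFiniteLimits E ∧ PreservesFiniteColimits E)
    (hT : PreservesFiniteLimits T ∧ PreservesFiniteColimits T)
    (ε : T ⟶ 𝟭 C₂) (η : T ⟶ E ⋙ ι) (α : ι ⋙ E ≅ 𝟭 C₁) (hε : ∀ X, IsIso (ε.app (ι.obj X)))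
    (hη : ∀ X, η.app (ι.obj X) ≫ ι.map (α.hom.app X) = ε.app (ι.obj X)) :
    ι.mapDerivedCategory.Full ∧ ι.mapDerivedCategory.Faithful := by
  obtain ⟨_, _⟩ := hE
  obtain ⟨_, _⟩ := hT
  have : E.Additive := E.additive_of_preserves_binary_products
  have : T.Additive := T.additive_of_preserves_binary_products
  let c := ComplexShape.up ℤ
  refine full_and_faithful_of_zigzag_of_isLocalization
    DerivedCategory.Q (HomologicalComplex.quasiIso C₁ c)
    DerivedCategory.Q (HomologicalComplex.quasiIso C₂ c)
    (ι := ι.mapHomologicalComplex c) (E := E.mapHomologicalComplex c)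
    (T := T.mapHomologicalComplex c)
    ι.mapDerivedCategoryFactors E.mapDerivedCategoryFactors T.mapDerivedCategoryFactors
    { app K := { f i := ε.app (K.X i), comm' i j _ := (ε.naturality (K.d i j)).symm }
      naturality _ _ f := HomologicalComplex.hom_ext _ _ fun i => ε.naturality (f.f i) }
    { app K := { f i := η.app (K.X i), comm' i j _ := (η.naturality (K.d i j)).symm }
      naturality _ _ f := HomologicalComplex.hom_ext _ _ fun i => η.naturality (f.f i) }
    (NatIso.ofComponents (fun K => HomologicalComplex.Hom.isoOfComponents
      (fun i => α.app (K.X i)) (fun i j _ => (α.hom.naturality (K.d i j)).symm))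
      (fun f => HomologicalComplex.hom_ext _ _ fun i => α.hom.naturality (f.f i)))
    (fun K => ?_) (fun K => ?_)
  · exact @HomologicalComplex.Hom.isIso_of_components _ _ _ _ _ _ _ _ fun i => hε (K.X i)
  · ext i
    exact hη (K.X i)

end DerivedCategory

/-- The hypotheses concern only limits, colimits and natural transformations, and additivity is
deduced from them, so any choice of abelian structures on the two categories is allowed. -/
theorem exact_and_mapDerivedCategory_full_and_faithful {ι : C₁ ⥤ C₂} {E : C₂ ⥤ C₁} {T : C₂ ⥤ C₂}
    [Abelian C₁] [Abelian C₂] (hι : PreservesFiniteLimits ι ∧ PreservesFiniteColimits ι)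
    (hE : PreservesFiniteLimits E ∧ PreservesFiniteColimits E)
    (hT : PreservesFiniteLimits T ∧ PreservesFiniteColimits T)
    (ε : T ⟶ 𝟭 C₂) (η : T ⟶ E ⋙ ι) (α : ι ⋙ E ≅ 𝟭 C₁) (hε : ∀ X, IsIso (ε.app (ι.obj X)))
    (hη : ∀ X, η.app (ι.obj X) ≫ ι.map (α.hom.app X) = ε.app (ι.obj X)) :
    ∃ (_ : ι.Additive) (_ : PreservesFiniteLimits ι) (_ : PreservesFiniteColimits ι),
      ∀ [HasDerivedCategory.{w₁} C₁] [HasDerivedCategory.{w₂} C₂],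
        ι.mapDerivedCategory.Full ∧ ι.mapDerivedCategory.Faithful := by
  obtain ⟨_, _⟩ := hι
  have := ι.additive_of_preserves_binary_products
  exact ⟨this, inferInstance, inferInstance,
    fun {_ _} => mapDerivedCategory_full_and_faithful hE hT ε η α hε hη⟩

end FullyFaithful

end FormalHodge

namespace FormalHodge

/-! ### Base change of maps of abelian groups -/

section BaseChange

variable {A : Type*} [CommRing A] {M N P : Type*} [AddCommGroup M] [AddCommGroup N]
  [AddCommGroup P]

theorem baseChange_injective [Module.Flat ℤ A] {f : M →ₗ[ℤ] N} (hf : Function.Injective f) :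
    Function.Injective (f.baseChange A) :=
  Module.Flat.lTensor_preserves_injective_linearMap (M := A) f hf

theorem baseChange_surjective {f : M →ₗ[ℤ] N} (hf : Function.Surjective f) :
    Function.Surjective (f.baseChange A) :=
  LinearMap.lTensor_surjective A hf

theorem baseChange_exact_of_flat [Module.Flat ℤ A] {f : M →ₗ[ℤ] N} {g : N →ₗ[ℤ] P}
    (h : Function.Exact f g) : Function.Exact (f.baseChange A) (g.baseChange A) :=
  Module.Flat.lTensor_exact A h

theorem baseChange_exact_of_surjective {f : M →ₗ[ℤ] N} {g : N →ₗ[ℤ] P}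
    (h : Function.Exact f g) (hg : Function.Surjective g) :
    Function.Exact (f.baseChange A) (g.baseChange A) :=
  lTensor_exact A h hg

theorem baseChange_comp_apply (f : M →ₗ[ℤ] N) (g : N →ₗ[ℤ] P) (x : A ⊗[ℤ] M) :
    g.baseChange A (f.baseChange A x) = (g ∘ₗ f).baseChange A x := by
  rw [LinearMap.baseChange_comp]; rfl

theorem baseChange_fst_inl (x : A ⊗[ℤ] M) :
    (LinearMap.fst ℤ M N).baseChange A ((LinearMap.inl ℤ M N).baseChange A x) = x := by
  rw [baseChange_comp_apply, LinearMap.fst_comp_inl, LinearMap.baseChange_id]; rfl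

theorem baseChange_snd_inr (x : A ⊗[ℤ] N) :
    (LinearMap.snd ℤ M N).baseChange A ((LinearMap.inr ℤ M N).baseChange A x) = x := by
  rw [baseChange_comp_apply, LinearMap.snd_comp_inr, LinearMap.baseChange_id]; rfl

theorem baseChange_fst_inr (x : A ⊗[ℤ] N) :
    (LinearMap.fst ℤ M N).baseChange A ((LinearMap.inr ℤ M N).baseChange A x) = 0 := by
  rw [baseChange_comp_apply, LinearMap.fst_comp_inr, LinearMap.baseChange_zero]; rfl

theorem baseChange_snd_inl (x : A ⊗[ℤ] M) :
    (LinearMap.snd ℤ M N).baseChange A ((LinearMap.inl ℤ M N).baseChange A x) = 0 := by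
  rw [baseChange_comp_apply, LinearMap.snd_comp_inl, LinearMap.baseChange_zero]; rfl

theorem baseChange_prod_eq (x : A ⊗[ℤ] (M × N)) :
    x = (LinearMap.inl ℤ M N).baseChange A ((LinearMap.fst ℤ M N).baseChange A x) +
      (LinearMap.inr ℤ M N).baseChange A ((LinearMap.snd ℤ M N).baseChange A x) := by
  rw [baseChange_comp_apply, baseChange_comp_apply, ← LinearMap.add_apply,
    ← LinearMap.baseChange_add]
  have : LinearMap.inl ℤ M N ∘ₗ LinearMap.fst ℤ M N + LinearMap.inr ℤ M N ∘ₗ LinearMap.snd ℤ M N =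
      LinearMap.id := by ext <;> simp
  rw [this, LinearMap.baseChange_id]; rfl

theorem le_comap_comap_baseChange {f : M →ₗ[ℤ] N} {g : N →ₗ[ℤ] P} {h : M →ₗ[ℤ] P}
    (hfg : g ∘ₗ f = h) {S : Submodule A (A ⊗[ℤ] M)} {T : Submodule A (A ⊗[ℤ] P)}
    (hST : S ≤ T.comap (h.baseChange A)) :
    S ≤ (T.comap (g.baseChange A)).comap (f.baseChange A) := by
  rwa [← Submodule.comap_comp, ← LinearMap.baseChange_comp, hfg]

theorem map_le_comap_baseChange {f : M →ₗ[ℤ] N} {g : N →ₗ[ℤ] P} {h : M →ₗ[ℤ] P}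
    (hfg : g ∘ₗ f = h) {S : Submodule A (A ⊗[ℤ] M)} {T : Submodule A (A ⊗[ℤ] P)}
    (hST : S ≤ T.comap (h.baseChange A)) :
    S.map (f.baseChange A) ≤ T.comap (g.baseChange A) :=
  Submodule.map_le_iff_le_comap.2 (le_comap_comap_baseChange hfg hST)

theorem sub_mem_complexify_of_comap {H K : Type u} [AddCommGroup H] [AddCommGroup K]
    {f : H →ₗ[ℤ] K} {S : Submodule ℚ (ℚ ⊗[ℤ] K)} {a b : ℂ ⊗[ℤ] H}
    (h : a - b ∈ complexify (S.comap (f.baseChange ℚ))) :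
    f.baseChange ℂ a - f.baseChange ℂ b ∈ complexify S := by
  rw [← map_sub]
  exact mem_complexify_comap.1 h

end BaseChange

/-! ### Kernels, cokernels and sums of mixed Hodge structures -/

namespace MHS

variable {H K L : MHS.{u}}

section Kernel

variable (f : H ⟶ K)

/-- The inclusion of the kernel of a morphism of mixed Hodge structures. -/
abbrev kerIncl : LinearMap.ker f.toLin →ₗ[ℤ] H.carrier := (LinearMap.ker f.toLin).subtype

theorem kerIncl_injective (A : Type*) [CommRing A] [Module.Flat ℤ A] :
    Function.Injective ((kerIncl f).baseChange A) :=
  baseChange_injective (LinearMap.ker f.toLin).injective_subtype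

theorem kerIncl_exact (A : Type*) [CommRing A] [Module.Flat ℤ A] :
    Function.Exact ((kerIncl f).baseChange A) (f.toLin.baseChange A) :=
  baseChange_exact_of_flat (f.toLin.exact_subtype_ker_map)

/-- The kernel of a morphism of mixed Hodge structures, with the induced filtrations. -/
noncomputable def ker : MHS.{u} where
  carrier := LinearMap.ker f.toLin
  W k := (H.W k).comap ((kerIncl f).baseChange ℚ)
  F p := (H.F p).comap ((kerIncl f).baseChange ℂ)
  monotone_W _ _ h := Submodule.comap_mono (H.monotone_W h)
  exists_W_eq_bot := H.exists_W_eq_bot.imp fun _ h => by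
    rw [h, ← LinearMap.ker, LinearMap.ker_eq_bot]
    exact kerIncl_injective f ℚ
  exists_W_eq_top := H.exists_W_eq_top.imp fun _ h => by rw [h, Submodule.comap_top]
  antitone_F _ _ h := Submodule.comap_mono (H.antitone_F h)
  exists_F_eq_bot := H.exists_F_eq_bot.imp fun _ h => by
    rw [h, ← LinearMap.ker, LinearMap.ker_eq_bot]
    exact kerIncl_injective f ℂ
  exists_F_eq_top := H.exists_F_eq_top.imp fun _ h => by rw [h, Submodule.comap_top]
  opposed k p q hk := by
    refine isCompl_grSub_iff.2 ⟨fun x hx => ?_, fun a ha b hb hak hbk hab => ?_⟩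
    · have hx' := mem_complexify_comap.1 hx
      obtain ⟨a, ha, b, hb, hak, hbk, hab, hfa, hfb⟩ :=
        H.opposedFiltrations.exists_sub_mem_of_map_eq_zero K.opposedFiltrations f.mem_W f.mem_F
          f.mem_conjF hk hx' ((kerIncl_exact f ℂ).apply_apply_eq_zero x)
      -- By flatness of ℂ over ℤ, the kernel of f_ℂ is ℂ ⊗ ker f, so components killed by f_ℂ come
      -- from the kernel.
      obtain ⟨a, rfl⟩ := (kerIncl_exact f ℂ a).1 hfa
      obtain ⟨b, rfl⟩ := (kerIncl_exact f ℂ b).1 hfb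
      refine ⟨a, ha, b, mem_conjSub_comap.2 hb, mem_complexify_comap.2 hak,
        mem_complexify_comap.2 hbk, mem_complexify_comap.2 ?_⟩
      rwa [map_sub, map_sub]
    · refine mem_complexify_comap.2 (H.opposedFiltrations.mem_of_sub_mem k p q hk _ ha _
        (mem_conjSub_comap.1 hb) (mem_complexify_comap.1 hak) (mem_complexify_comap.1 hbk)
        (sub_mem_complexify_of_comap hab))

theorem levelLE_ker {n : ℕ} (h : levelLE n H) : levelLE n (ker f) :=
  levelLE_iff.2 fun p q _ ha _ hb hak hbk hab h0 =>
    levelLE_iff.1 h p q _ ha _ (mem_conjSub_comap.1 hb) (mem_complexify_comap.1 hak)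
      (mem_complexify_comap.1 hbk) (sub_mem_complexify_of_comap hab)
      fun h => h0 (mem_complexify_comap.2 h)

/-- The inclusion of the kernel as a morphism. -/
noncomputable def kerι : ker f ⟶ H where
  toLin := kerIncl f
  map_W _ := le_rfl
  map_F _ := le_rfl

/-- The universal property of the kernel. -/
noncomputable def kerLift (g : L ⟶ H) (h : ∀ x, f.toLin (g.toLin x) = 0) : L ⟶ ker f where
  toLin := g.toLin.codRestrict _ h
  map_W k := le_comap_comap_baseChange (LinearMap.subtype_comp_codRestrict _ _ _) (g.map_W k)
  map_F k := le_comap_comap_baseChange (LinearMap.subtype_comp_codRestrict _ _ _) (g.map_F k)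

end Kernel

section Cokernel

variable (f : H ⟶ K)

/-- The projection to the cokernel of a morphism of mixed Hodge structures. -/
abbrev cokerProj : K.carrier →ₗ[ℤ] K.carrier ⧸ LinearMap.range f.toLin :=
  (LinearMap.range f.toLin).mkQ

theorem cokerProj_surjective (A : Type*) [CommRing A] :
    Function.Surjective ((cokerProj f).baseChange A) :=
  baseChange_surjective (LinearMap.range f.toLin).mkQ_surjective

theorem cokerProj_exact (A : Type*) [CommRing A] :
    Function.Exact (f.toLin.baseChange A) ((cokerProj f).baseChange A) :=
  baseChange_exact_of_surjective f.toLin.exact_map_mkQ_range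
    (LinearMap.range f.toLin).mkQ_surjective

/-- A class in the cokernel has one lift in F^p and another in W_k; strictness merges them into one
lift in F^p ∩ W_k, and likewise for the conjugate filtration. A last correction by the image
restores agreement modulo W_{k-1}. The inequality covers both uses: p + q = k + 1 for opposedness
and p + q = k for Hodge types. -/
theorem exists_cokerProj_eq {k p q : ℤ} (hk : p + q ≤ k + 1)
    {a b : ℂ ⊗[ℤ] (K.carrier ⧸ LinearMap.range f.toLin)}
    (ha : a ∈ (K.F p).map ((cokerProj f).baseChange ℂ))
    (hb : b ∈ conjSub ((K.F q).map ((cokerProj f).baseChange ℂ)))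
    (hak : a ∈ complexify ((K.W k).map ((cokerProj f).baseChange ℚ)))
    (hbk : b ∈ complexify ((K.W k).map ((cokerProj f).baseChange ℚ)))
    (hab : a - b ∈ complexify ((K.W (k - 1)).map ((cokerProj f).baseChange ℚ))) :
    ∃ a' ∈ K.F p, ∃ b' ∈ conjSub (K.F q), a' ∈ complexify (K.W k) ∧ b' ∈ complexify (K.W k) ∧
      a' - b' ∈ complexify (K.W (k - 1)) ∧ (cokerProj f).baseChange ℂ a' = a := by
  rw [complexify_map] at hak hbk hab
  rw [conjSub_map] at hb
  obtain ⟨a₀, ha₀, rfl⟩ := ha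
  obtain ⟨b₀, hb₀, rfl⟩ := hb
  obtain ⟨a₁, ha₁, haa⟩ := hak
  obtain ⟨b₁, hb₁, hbb⟩ := hbk
  obtain ⟨w, hw, hwab⟩ := hab
  have hH := H.opposedFiltrations
  have hK := K.opposedFiltrations
  obtain ⟨x, hx⟩ := (cokerProj_exact f ℂ (a₀ - a₁)).1 (by rw [map_sub, haa, sub_self])
  obtain ⟨y, hy⟩ := (cokerProj_exact f ℂ (b₀ - b₁)).1 (by rw [map_sub, hbb, sub_self])
  obtain ⟨a₂, ha₂, ha₂k, x₁, -, hax, -⟩ :=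
    hH.exists_add_map_eq hK f.mem_W f.mem_F f.mem_conjF ha₀ ha₁ hx.symm
  obtain ⟨b₂, hb₂, hb₂k, y₁, -, hby, -⟩ :=
    hH.symm.exists_add_map_eq hK.symm f.mem_W f.mem_conjF f.mem_F hb₀ hb₁ hy.symm
  have hpa : (cokerProj f).baseChange ℂ a₂ = (cokerProj f).baseChange ℂ a₀ := by
    rw [hax, map_add, (cokerProj_exact f ℂ).apply_apply_eq_zero, add_zero]
  have hpb : (cokerProj f).baseChange ℂ b₂ = (cokerProj f).baseChange ℂ b₀ := by
    rw [hby, map_add, (cokerProj_exact f ℂ).apply_apply_eq_zero, add_zero]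
  obtain ⟨z, hz⟩ := (cokerProj_exact f ℂ (a₂ - b₂ - w)).1
    (by rw [map_sub, map_sub, hpa, hpb, hwab, sub_self])
  obtain ⟨s, t, hs, ht, hsk, htk, hst⟩ := hH.exists_sub_map_sub_mem hK f.mem_W f.mem_F f.mem_conjF
    hk ha₂ hb₂ ha₂k hb₂k (x := z) (by rwa [hz, sub_sub_cancel])
  refine ⟨_, hs, _, ht, hsk, htk, hst, ?_⟩
  rw [map_sub, (cokerProj_exact f ℂ).apply_apply_eq_zero, sub_zero, hpa]

/-- The cokernel of a morphism of mixed Hodge structures, with the induced filtrations. -/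
noncomputable def coker : MHS.{u} where
  carrier := K.carrier ⧸ LinearMap.range f.toLin
  W k := (K.W k).map ((cokerProj f).baseChange ℚ)
  F p := (K.F p).map ((cokerProj f).baseChange ℂ)
  monotone_W _ _ h := Submodule.map_mono (K.monotone_W h)
  exists_W_eq_bot := K.exists_W_eq_bot.imp fun _ h => by rw [h, Submodule.map_bot]
  exists_W_eq_top := K.exists_W_eq_top.imp fun _ h => by
    rw [h, Submodule.map_top, LinearMap.range_eq_top]
    exact cokerProj_surjective f ℚ
  antitone_F _ _ h := Submodule.map_mono (K.antitone_F h)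
  exists_F_eq_bot := K.exists_F_eq_bot.imp fun _ h => by rw [h, Submodule.map_bot]
  exists_F_eq_top := K.exists_F_eq_top.imp fun _ h => by
    rw [h, Submodule.map_top, LinearMap.range_eq_top]
    exact cokerProj_surjective f ℂ
  opposed k p q hk := by
    refine isCompl_grSub_iff.2 ⟨fun x hx => ?_, fun a ha b hb hak hbk hab => ?_⟩
    · simp only [complexify_map, conjSub_map] at hx ⊢
      obtain ⟨x, hx, rfl⟩ := hx
      obtain ⟨a, ha, b, hb, hak, hbk, hab⟩ := K.opposedFiltrations.exists_sub_mem k p q hk x hx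
      exact ⟨_, ⟨a, ha, rfl⟩, _, ⟨b, hb, rfl⟩, ⟨a, hak, rfl⟩, ⟨b, hbk, rfl⟩, _, hab, by
        rw [map_sub, map_sub]⟩
    · obtain ⟨a', ha', b', hb', hak', hbk', hab', rfl⟩ :=
        exists_cokerProj_eq f hk.le ha hb hak hbk hab
      rw [complexify_map]
      exact ⟨a', K.opposedFiltrations.mem_of_sub_mem k p q hk a' ha' b' hb' hak' hbk' hab', rfl⟩

theorem levelLE_coker {n : ℕ} (h : levelLE n K) : levelLE n (coker f) := by
  refine levelLE_iff.2 fun p q a ha b hb hak hbk hab h0 => ?_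
  obtain ⟨a', ha', b', hb', hak', hbk', hab', rfl⟩ :=
    exists_cokerProj_eq f (by omega) ha hb hak hbk hab
  exact levelLE_iff.1 h p q a' ha' b' hb' hak' hbk' hab' fun h =>
    h0 ((complexify_map _ _).ge ⟨a', h, rfl⟩)

/-- The projection to the cokernel as a morphism. -/
noncomputable def cokerπ : K ⟶ coker f where
  toLin := cokerProj f
  map_W _ := Submodule.le_comap_map _ _
  map_F _ := Submodule.le_comap_map _ _

/-- The universal property of the cokernel. -/
noncomputable def cokerDesc (g : K ⟶ L) (h : ∀ x, g.toLin (f.toLin x) = 0) : coker f ⟶ L where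
  toLin := (LinearMap.range f.toLin).liftQ g.toLin (by rintro _ ⟨x, rfl⟩; exact h x)
  map_W k := map_le_comap_baseChange (Submodule.liftQ_mkQ _ _ _) (g.map_W k)
  map_F k := map_le_comap_baseChange (Submodule.liftQ_mkQ _ _ _) (g.map_F k)

end Cokernel

section Prod

variable (H K)

/-- The direct sum of two mixed Hodge structures. -/
noncomputable def prod : MHS.{u} where
  carrier := H.carrier × K.carrier
  W k := (H.W k).comap ((LinearMap.fst ℤ _ _).baseChange ℚ) ⊓
    (K.W k).comap ((LinearMap.snd ℤ _ _).baseChange ℚ)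
  F p := (H.F p).comap ((LinearMap.fst ℤ _ _).baseChange ℂ) ⊓
    (K.F p).comap ((LinearMap.snd ℤ _ _).baseChange ℂ)
  monotone_W _ _ h := inf_le_inf (Submodule.comap_mono (H.monotone_W h))
    (Submodule.comap_mono (K.monotone_W h))
  exists_W_eq_bot := by
    obtain ⟨k, hk⟩ := H.exists_W_eq_bot
    obtain ⟨l, hl⟩ := K.exists_W_eq_bot
    refine ⟨min k l, (Submodule.eq_bot_iff _).2 fun x hx => ?_⟩
    have h₁ := H.monotone_W (min_le_left k l) hx.1
    have h₂ := K.monotone_W (min_le_right k l) hx.2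
    rw [hk, Submodule.mem_bot] at h₁
    rw [hl, Submodule.mem_bot] at h₂
    rw [baseChange_prod_eq x, h₁, h₂, map_zero, map_zero, add_zero]
  exists_W_eq_top := by
    obtain ⟨k, hk⟩ := H.exists_W_eq_top
    obtain ⟨l, hl⟩ := K.exists_W_eq_top
    exact ⟨max k l, top_unique fun x _ => ⟨H.monotone_W (le_max_left k l) (by rw [hk]; trivial),
      K.monotone_W (le_max_right k l) (by rw [hl]; trivial)⟩⟩
  antitone_F _ _ h := inf_le_inf (Submodule.comap_mono (H.antitone_F h))
    (Submodule.comap_mono (K.antitone_F h))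
  exists_F_eq_bot := by
    obtain ⟨k, hk⟩ := H.exists_F_eq_bot
    obtain ⟨l, hl⟩ := K.exists_F_eq_bot
    refine ⟨max k l, (Submodule.eq_bot_iff _).2 fun x hx => ?_⟩
    have h₁ := H.antitone_F (le_max_left k l) hx.1
    have h₂ := K.antitone_F (le_max_right k l) hx.2
    rw [hk, Submodule.mem_bot] at h₁
    rw [hl, Submodule.mem_bot] at h₂
    rw [baseChange_prod_eq x, h₁, h₂, map_zero, map_zero, add_zero]
  exists_F_eq_top := by
    obtain ⟨k, hk⟩ := H.exists_F_eq_top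
    obtain ⟨l, hl⟩ := K.exists_F_eq_top
    exact ⟨min k l, top_unique fun x _ => ⟨H.antitone_F (min_le_left k l) (by rw [hk]; trivial),
      K.antitone_F (min_le_right k l) (by rw [hl]; trivial)⟩⟩
  opposed k p q hk := by
    refine isCompl_grSub_iff.2 ⟨fun x hx => ?_, fun a ha b hb hak hbk hab => ?_⟩
    · rw [complexify_inf] at hx
      obtain ⟨a, ha, b, hb, hak, hbk, hab⟩ := H.opposedFiltrations.exists_sub_mem k p q hk _
        (mem_complexify_comap.1 hx.1)
      obtain ⟨c, hc, d, hd, hck, hdk, hcd⟩ := K.opposedFiltrations.exists_sub_mem k p q hk _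
        (mem_complexify_comap.1 hx.2)
      have key (S : Submodule ℂ (ℂ ⊗[ℤ] H.carrier)) (T : Submodule ℂ (ℂ ⊗[ℤ] K.carrier))
          {y : ℂ ⊗[ℤ] H.carrier} {z : ℂ ⊗[ℤ] K.carrier} (hy : y ∈ S) (hz : z ∈ T) :
          (LinearMap.inl ℤ _ _).baseChange ℂ y + (LinearMap.inr ℤ _ _).baseChange ℂ z ∈
            S.comap ((LinearMap.fst ℤ _ _).baseChange ℂ) ⊓
              T.comap ((LinearMap.snd ℤ _ _).baseChange ℂ) := by
        constructor
        · simpa [baseChange_fst_inl, baseChange_fst_inr] using hy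
        · simpa [baseChange_snd_inl, baseChange_snd_inr] using hz
      have hW (l : ℤ) {y : ℂ ⊗[ℤ] H.carrier} {z : ℂ ⊗[ℤ] K.carrier} (hy : y ∈ complexify (H.W l))
          (hz : z ∈ complexify (K.W l)) := by
        have := key _ _ hy hz
        simp only [Submodule.mem_inf, Submodule.mem_comap, ← mem_complexify_comap] at this
        exact (complexify_inf _ _).ge this
      refine ⟨_, key _ _ ha hc, _, (key _ _ hb hd).imp mem_conjSub_comap.2 mem_conjSub_comap.2,
        hW _ hak hck, hW _ hbk hdk, ?_⟩
      convert hW _ hab hcd using 1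
      conv_lhs => rw [baseChange_prod_eq x]
      simp only [map_sub]
      abel
    · rw [complexify_inf] at hak hbk hab ⊢
      exact ⟨mem_complexify_comap.2 (H.opposedFiltrations.mem_of_sub_mem k p q hk _ ha.1 _
        (mem_conjSub_comap.1 hb.1) (mem_complexify_comap.1 hak.1) (mem_complexify_comap.1 hbk.1)
        (sub_mem_complexify_of_comap hab.1)), mem_complexify_comap.2 (K.opposedFiltrations.mem_of_sub_mem k p q hk _ ha.2 _
        (mem_conjSub_comap.1 hb.2) (mem_complexify_comap.1 hak.2) (mem_complexify_comap.1 hbk.2)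
        (sub_mem_complexify_of_comap hab.2))⟩

variable {H K}

theorem levelLE_prod {n : ℕ} (hH : levelLE n H) (hK : levelLE n K) : levelLE n (prod H K) := by
  refine levelLE_iff.2 fun p q a ha b hb hak hbk hab h0 => ?_
  have hak' := (complexify_inf _ _).le hak
  have hbk' := (complexify_inf _ _).le hbk
  have hab' := (complexify_inf _ _).le hab
  rcases not_and_or.1 (fun h => h0 ((complexify_inf _ _).ge h)) with h0 | h0
  · exact levelLE_iff.1 hH p q _ ha.1 _ (mem_conjSub_comap.1 hb.1) (mem_complexify_comap.1 hak'.1)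
      (mem_complexify_comap.1 hbk'.1) (sub_mem_complexify_of_comap hab'.1)
      fun h => h0 (mem_complexify_comap.2 h)
  · exact levelLE_iff.1 hK p q _ ha.2 _ (mem_conjSub_comap.1 hb.2) (mem_complexify_comap.1 hak'.2)
      (mem_complexify_comap.1 hbk'.2) (sub_mem_complexify_of_comap hab'.2)
      fun h => h0 (mem_complexify_comap.2 h)

end Prod

end MHS

end FormalHodge

namespace FormalHodge

/-! ### The abelian category of mixed Hodge structures of level at most n -/

namespace MHS

variable {H K L : MHS.{u}}

section Preadditive

instance : Zero (H ⟶ K) where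
  zero :=
    { toLin := 0
      map_W := fun k x _ => by simp
      map_F := fun k x _ => by simp }

instance : Add (H ⟶ K) where
  add f g :=
    { toLin := f.toLin + g.toLin
      map_W := fun k x hx => by
        rw [Submodule.mem_comap, LinearMap.baseChange_add]
        exact add_mem (f.map_W k hx) (g.map_W k hx)
      map_F := fun k x hx => by
        rw [Submodule.mem_comap, LinearMap.baseChange_add]
        exact add_mem (f.map_F k hx) (g.map_F k hx) }

instance : Neg (H ⟶ K) where
  neg f :=
    { toLin := -f.toLin
      map_W := fun k x hx => by
        rw [Submodule.mem_comap, LinearMap.baseChange_neg]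
        exact neg_mem (f.map_W k hx)
      map_F := fun k x hx => by
        rw [Submodule.mem_comap, LinearMap.baseChange_neg]
        exact neg_mem (f.map_F k hx) }

instance : AddCommGroup (H ⟶ K) where
  add_assoc f g h := hom_ext (add_assoc f.toLin g.toLin h.toLin)
  zero_add f := hom_ext (zero_add f.toLin)
  add_zero f := hom_ext (add_zero f.toLin)
  add_comm f g := hom_ext (add_comm f.toLin g.toLin)
  neg_add_cancel f := hom_ext (neg_add_cancel f.toLin)
  nsmul := nsmulRec
  zsmul := zsmulRec

scoped instance instPreadditive : Preadditive MHS.{u} where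
  add_comp _ _ _ f f' g := hom_ext (LinearMap.comp_add f.toLin f'.toLin g.toLin)
  comp_add _ _ _ f g g' := hom_ext (LinearMap.add_comp f.toLin g'.toLin g.toLin)

end Preadditive

/-- The projections of a direct sum of mixed Hodge structures. -/
noncomputable def prodFst (H K : MHS.{u}) : prod H K ⟶ H where
  toLin := LinearMap.fst ℤ _ _
  map_W _ := inf_le_left
  map_F _ := inf_le_left

/-- The second projection. -/
noncomputable def prodSnd (H K : MHS.{u}) : prod H K ⟶ K where
  toLin := LinearMap.snd ℤ _ _
  map_W _ := inf_le_right
  map_F _ := inf_le_right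

/-- The morphism to a direct sum with given components. -/
noncomputable def prodLift (f : L ⟶ H) (g : L ⟶ K) : L ⟶ prod H K where
  toLin := f.toLin.prod g.toLin
  map_W k x hx := by
    have h₁ : (LinearMap.fst ℤ H.carrier K.carrier).baseChange ℚ
        ((f.toLin.prod g.toLin).baseChange ℚ x) ∈ H.W k := by
      rw [baseChange_comp_apply, LinearMap.fst_prod]
      exact f.map_W k hx
    have h₂ : (LinearMap.snd ℤ H.carrier K.carrier).baseChange ℚ
        ((f.toLin.prod g.toLin).baseChange ℚ x) ∈ K.W k := by
      rw [baseChange_comp_apply, LinearMap.snd_prod]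
      exact g.map_W k hx
    exact ⟨h₁, h₂⟩
  map_F k x hx := by
    have h₁ : (LinearMap.fst ℤ H.carrier K.carrier).baseChange ℂ
        ((f.toLin.prod g.toLin).baseChange ℂ x) ∈ H.F k := by
      rw [baseChange_comp_apply, LinearMap.fst_prod]
      exact f.map_F k hx
    have h₂ : (LinearMap.snd ℤ H.carrier K.carrier).baseChange ℂ
        ((f.toLin.prod g.toLin).baseChange ℂ x) ∈ K.F k := by
      rw [baseChange_comp_apply, LinearMap.snd_prod]
      exact g.map_F k hx
    exact ⟨h₁, h₂⟩

/-- Strictness is the point: the inverse group homomorphism preserves W and F because every filtered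
element of the target is the image of an element in the same filtration step. -/
theorem exists_inverse_of_bijective (f : H ⟶ K) (hf : Function.Bijective f.toLin) :
    ∃ g : K ⟶ H, f ≫ g = 𝟙 H ∧ g ≫ f = 𝟙 K := by
  let e := LinearEquiv.ofBijective f.toLin hf
  have he : f.toLin ∘ₗ e.symm.toLinearMap = LinearMap.id := LinearMap.ext e.apply_symm_apply
  have he' : e.symm.toLinearMap ∘ₗ f.toLin = LinearMap.id := LinearMap.ext e.symm_apply_apply
  have cancel (A : Type) [CommRing A] (x : A ⊗[ℤ] K.carrier) :
      f.toLin.baseChange A (e.symm.toLinearMap.baseChange A x) = x := by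
    rw [baseChange_comp_apply, he, LinearMap.baseChange_id]; rfl
  have cancel' (A : Type) [CommRing A] (x : A ⊗[ℤ] H.carrier) :
      e.symm.toLinearMap.baseChange A (f.toLin.baseChange A x) = x := by
    rw [baseChange_comp_apply, he', LinearMap.baseChange_id]; rfl
  have hH := H.opposedFiltrations
  have hK := K.opposedFiltrations
  refine ⟨⟨e.symm.toLinearMap, fun k x hx => ?_, fun p x hx => ?_⟩, hom_ext he', hom_ext he⟩
  -- Strictness holds for the complexified W; membership of a rational vector can be tested after
  -- complexification.
  · rw [Submodule.mem_comap, ← ratToComplex_mem_complexify, ratToComplex_baseChange]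
    rw [← ratToComplex_mem_complexify, ← cancel ℂ (ratToComplex _ x)] at hx
    obtain ⟨w, hw, hwx⟩ := hH.exists_map_eq_of_mem_W hK f.mem_W f.mem_F f.mem_conjF hx
    rw [cancel] at hwx
    rwa [← hwx, cancel']
  · obtain ⟨k, hk⟩ := H.exists_W_eq_top
    rw [← cancel ℂ x] at hx
    obtain ⟨w, hw, -, hwx⟩ := hH.exists_map_eq_of_mem_F hK f.mem_W f.mem_F f.mem_conjF
      (k := k) (by rw [hk, complexify_top]; trivial) hx
    rw [cancel] at hwx
    rwa [Submodule.mem_comap, ← hwx, cancel']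

end MHS

open scoped MHS

section Level

variable (n : ℕ)

/-- The underlying abelian group of a mixed Hodge structure of level `≤ n`. -/
noncomputable def MHSLevel.toAb : MHSLevel.{u} n ⥤ AddCommGrpCat.{u} where
  obj H := AddCommGrpCat.of H.obj.carrier
  map f := AddCommGrpCat.ofHom f.hom.toLin.toAddMonoidHom

instance : (MHSLevel.toAb.{u} n).Additive where
  map_add := rfl

instance : HasZeroObject (MHSLevel.{u} n) :=
  ⟨⟨⟨MHS.zero, MHS.levelLE_zero n⟩,
    (IsZero.iff_id_eq_zero _).2 (by
      refine ObjectProperty.hom_ext _ (MHS.hom_ext (LinearMap.ext fun x => ?_))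
      exact Subsingleton.elim (α := PUnit) _ _)⟩⟩

instance : HasBinaryBiproducts (MHSLevel.{u} n) where
  has_binary_biproduct H K := by
    let b : BinaryBicone H K :=
      { pt := ⟨MHS.prod H.obj K.obj, MHS.levelLE_prod H.property K.property⟩
        fst := ObjectProperty.homMk (MHS.prodFst _ _)
        snd := ObjectProperty.homMk (MHS.prodSnd _ _)
        inl := ObjectProperty.homMk (MHS.prodLift (𝟙 _) 0)
        inr := ObjectProperty.homMk (MHS.prodLift 0 (𝟙 _))
        inl_fst := rfl
        inl_snd := rfl
        inr_fst := rfl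
        inr_snd := rfl }
    refine hasBinaryBiproduct_of_total b
      (ObjectProperty.hom_ext _ (MHS.hom_ext (LinearMap.ext fun x => ?_)))
    exact Prod.fst_add_snd x
theorem MHSLevel.detectsAbelian :
    DetectsAbelian (fun _ : Unit => MHSLevel.toAb.{u} n) where
  isIso_of_bijective f hf := by
    obtain ⟨g, hfg, hgf⟩ := MHS.exists_inverse_of_bijective f.hom (hf ())
    exact ⟨ObjectProperty.homMk g, ObjectProperty.hom_ext _ hfg, ObjectProperty.hom_ext _ hgf⟩
  exists_kernel {H K} f := by
    refine ⟨⟨MHS.ker f.hom, MHS.levelLE_ker _ H.property⟩, ObjectProperty.homMk (MHS.kerι f.hom),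
      ObjectProperty.hom_ext _ (MHS.hom_ext (LinearMap.ext fun x => x.2)), ⟨?_⟩, fun _ =>
      ⟨Subtype.val_injective, fun x hx => ⟨⟨x, hx⟩, rfl⟩⟩⟩
    refine KernelFork.IsLimit.ofι _ _
      (fun g hg => ObjectProperty.homMk (MHS.kerLift f.hom g.hom fun x => ?_)) ?_ ?_
    · exact LinearMap.congr_fun (congr_arg (fun h => h.hom.toLin) hg) x
    · intros; rfl
    · intro L g hg m hm
      refine ObjectProperty.hom_ext _ (MHS.hom_ext (LinearMap.ext fun x => Subtype.ext ?_))
      exact LinearMap.congr_fun (congr_arg (fun h => h.hom.toLin) hm) x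
  exists_cokernel {H K} f := by
    refine ⟨⟨MHS.coker f.hom, MHS.levelLE_coker _ K.property⟩,
      ObjectProperty.homMk (MHS.cokerπ f.hom),
      ObjectProperty.hom_ext _ (MHS.hom_ext (LinearMap.ext fun x =>
        (Submodule.Quotient.mk_eq_zero _).2 ⟨x, rfl⟩)), ⟨?_⟩, fun _ =>
      ⟨(LinearMap.range f.hom.toLin).mkQ_surjective, fun x hx => (Submodule.Quotient.mk_eq_zero _).1 hx⟩⟩
    refine CokernelCofork.IsColimit.ofπ _ _
      (fun g hg => ObjectProperty.homMk (MHS.cokerDesc f.hom g.hom fun x => ?_)) ?_ ?_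
    · exact LinearMap.congr_fun (congr_arg (fun h => h.hom.toLin) hg) x
    · intros; rfl
    · intro L g hg m hm
      refine ObjectProperty.hom_ext _ (MHS.hom_ext (LinearMap.ext fun x => ?_))
      obtain ⟨x, rfl⟩ := Submodule.mkQ_surjective _ x
      exact LinearMap.congr_fun (congr_arg (fun h => h.hom.toLin) hm) x

noncomputable scoped instance MHSLevel.instAbelian : Abelian (MHSLevel.{u} n) :=
  have : HasFiniteProducts (MHSLevel.{u} n) := hasFiniteProducts_of_has_binary_and_terminal
  (MHSLevel.detectsAbelian n).abelian

end Level

end FormalHodge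

namespace FormalHodge

open scoped MHS MHSLevel

section ExactFamilies

universe v' u' t

variable {C : Type u'} [Category.{v'} C] {I : Type t} {G : I → C ⥤ AddCommGrpCat.{u}}

namespace DetectsExact

variable [Abelian C] (hG : DetectsExact G)

include hG

theorem kernel_ι_injective (i : I) {X Y : C} (f : X ⟶ Y) :
    Function.Injective ((G i).map (kernel.ι f)).hom :=
  (hG.mono_iff _).1 inferInstance i

theorem exists_kernel_ι_eq (i : I) {X Y : C} (f : X ⟶ Y) (x : (G i).obj X)
    (hx : ((G i).map f).hom x = 0) : ∃ y, ((G i).map (kernel.ι f)).hom y = x :=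
  (hG.exact_iff (ShortComplex.mk _ _ (kernel.condition f))).1 (ShortComplex.exact_kernel f) i x hx

theorem cokernel_π_surjective (i : I) {X Y : C} (f : X ⟶ Y) :
    Function.Surjective ((G i).map (cokernel.π f)).hom :=
  (hG.epi_iff _).1 inferInstance i

theorem exists_eq_of_cokernel_π_eq_zero (i : I) {X Y : C} (f : X ⟶ Y) (y : (G i).obj Y)
    (hy : ((G i).map (cokernel.π f)).hom y = 0) : ∃ x, ((G i).map f).hom x = y :=
  (hG.exact_iff (ShortComplex.mk _ _ (cokernel.condition f))).1
    (ShortComplex.exact_cokernel f) i y hy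

end DetectsExact

end ExactFamilies

/-! ### Diagrams of vector spaces -/

section VectorSpaces

/-- The underlying abelian group of a finite-dimensional complex vector space. -/
noncomputable def vecToAb : FGModuleCat.{u} ℂ ⥤ AddCommGrpCat.{u} :=
  forget₂ (FGModuleCat.{u} ℂ) (ModuleCat.{u} ℂ) ⋙ forget₂ (ModuleCat.{u} ℂ) AddCommGrpCat.{u}

theorem vec_detectsExact : DetectsExact (fun _ : Unit => vecToAb.{u}) where
  isIso_of_bijective f hf := by
    have h : IsIso ((forget₂ (ModuleCat.{u} ℂ) AddCommGrpCat.{u}).map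
        ((forget₂ (FGModuleCat.{u} ℂ) (ModuleCat.{u} ℂ)).map f)) :=
      (ConcreteCategory.isIso_iff_bijective _).2 (hf ())
    have := isIso_of_reflects_iso ((forget₂ (FGModuleCat.{u} ℂ) (ModuleCat.{u} ℂ)).map f)
      (forget₂ (ModuleCat.{u} ℂ) AddCommGrpCat.{u})
    exact isIso_of_reflects_iso f (forget₂ (FGModuleCat.{u} ℂ) (ModuleCat.{u} ℂ))
  preservesFiniteLimits _ := comp_preservesFiniteLimits _ _
  preservesFiniteColimits _ := comp_preservesFiniteColimits _ _

variable (n : ℕ)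

/-- The underlying abelian group of a component of a diagram of complex vector spaces. -/
noncomputable def VecDiag.toAb (j : Fin n) : VecDiag.{u} n ⥤ AddCommGrpCat.{u} :=
  (evaluation (Fin n) (FGModuleCat.{u} ℂ)).obj j ⋙ vecToAb

theorem VecDiag.detectsExact : DetectsExact (VecDiag.toAb.{u} n) where
  isIso_of_bijective f hf := by
    have (j : Fin n) : IsIso (f.app j) := vec_detectsExact.isIso_of_bijective _ fun _ => hf j
    exact NatIso.isIso_of_isIso_app f
  preservesFiniteLimits j :=
    have := vec_detectsExact.preservesFiniteLimits ()
    comp_preservesFiniteLimits _ _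
  preservesFiniteColimits j :=
    have := vec_detectsExact.preservesFiniteColimits ()
    comp_preservesFiniteColimits _ _

end VectorSpaces

theorem MHSLevel.detectsExact (n : ℕ) : DetectsExact (fun _ : Unit => MHSLevel.toAb.{u} n) :=
  have : HasFiniteProducts (MHSLevel.{u} n) := hasFiniteProducts_of_has_binary_and_terminal
  (MHSLevel.detectsAbelian n).detectsExact

/-! ### Exactness of the Hodge quotients -/

section QuotF

theorem MHS.exists_map_eq_of_mem_F {H K : MHS.{u}} (f : H ⟶ K) {p : ℤ} {x : ℂ ⊗[ℤ] H.carrier}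
    (hx : f.toLin.baseChange ℂ x ∈ K.F p) :
    ∃ a ∈ H.F p, f.toLin.baseChange ℂ a = f.toLin.baseChange ℂ x := by
  obtain ⟨k, hk⟩ := H.exists_W_eq_top
  obtain ⟨a, ha, -, hax⟩ := H.opposedFiltrations.exists_map_eq_of_mem_F K.opposedFiltrations
    f.mem_W f.mem_F f.mem_conjF (k := k) (by rw [hk, complexify_top]; trivial) hx
  exact ⟨a, ha, hax⟩

variable (n : ℕ)

/-- The functor sending `H` to the diagram of the `H_ℂ / F^i`. -/
noncomputable def quotFFunctor : MHSLevel.{u} n ⥤ VecDiag.{u} n where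
  obj H := H.obj.quotF n
  map f := MHS.quotFMap n f.hom
  map_id H := MHS.quotFMap_id n H.obj
  map_comp f g := MHS.quotFMap_comp n f.hom g.hom

instance : (quotFFunctor.{u} n).Additive where
  map_add {H K f g} := by
    refine NatTrans.ext (funext fun j => FGModuleCat.hom_ext (LinearMap.ext fun x => ?_))
    obtain ⟨y, rfl⟩ := Submodule.mkQ_surjective _ x
    change Submodule.mkQ (K.obj.F ((n : ℤ) - (j : ℕ))) ((f.hom.toLin + g.hom.toLin).baseChange ℂ y) =
      Submodule.mkQ (K.obj.F ((n : ℤ) - (j : ℕ))) (f.hom.toLin.baseChange ℂ y) +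
        Submodule.mkQ (K.obj.F ((n : ℤ) - (j : ℕ))) (g.hom.toLin.baseChange ℂ y)
    rw [LinearMap.baseChange_add, LinearMap.add_apply, map_add]

/-- Tensoring with ℂ is exact, and strictness for F makes the sequence of the F^p exact as well, so
the quotients form exact sequences. -/
theorem quotFFunctor_exact :
    PreservesFiniteLimits (quotFFunctor.{u} n) ∧ PreservesFiniteColimits (quotFFunctor.{u} n) := by
  refine preservesFiniteLimits_and_colimits (VecDiag.detectsExact n) _ fun S hS j => ?_
  have hm := (MHSLevel.detectsExact n).mono_iff S.f
  have he := (MHSLevel.detectsExact n).epi_iff S.g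
  have hf : Function.Injective S.f.hom.toLin := hm.1 hS.mono_f ()
  have hg : Function.Surjective S.g.hom.toLin := he.1 hS.epi_g ()
  have hfg : Function.Exact S.f.hom.toLin S.g.hom.toLin := fun x =>
    ⟨((MHSLevel.detectsExact n).exact_iff S).1 hS.exact () x, by
      rintro ⟨y, rfl⟩
      exact (MHSLevel.detectsExact n).map_comp_eq_zero S () y⟩
  have hfgC := baseChange_exact_of_flat (A := ℂ) hfg
  refine ⟨?_, ?_, ?_⟩
  · change Function.Injective (Submodule.mapQ _ _ (S.f.hom.toLin.baseChange ℂ) (S.f.hom.map_F _))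
    rw [← LinearMap.ker_eq_bot, Submodule.eq_bot_iff]
    intro x hx
    obtain ⟨x, rfl⟩ := Submodule.mkQ_surjective _ x
    obtain ⟨a, ha, hax⟩ := MHS.exists_map_eq_of_mem_F S.f.hom
      ((Submodule.Quotient.mk_eq_zero _).1 hx)
    rw [← baseChange_injective hf hax]
    exact (Submodule.Quotient.mk_eq_zero _).2 ha
  · intro x hx
    obtain ⟨x, rfl⟩ := Submodule.mkQ_surjective _ x
    -- Subtracting an element of F^p with the same image replaces a representative mapping into F^p
    -- by one mapping to zero, without changing its class.
    obtain ⟨a, ha, hax⟩ := MHS.exists_map_eq_of_mem_F S.g.hom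
      ((Submodule.Quotient.mk_eq_zero _).1 hx)
    obtain ⟨y, hy⟩ := (hfgC (x - a)).1 (by rw [map_sub, hax, sub_self])
    refine ⟨Submodule.Quotient.mk y, (Submodule.Quotient.eq _).2 ?_⟩
    rw [hy, sub_sub_cancel_left]
    exact neg_mem ha
  · intro x
    obtain ⟨x, rfl⟩ := Submodule.mkQ_surjective _ x
    obtain ⟨y, rfl⟩ := baseChange_surjective (A := ℂ) hg x
    exact ⟨Submodule.Quotient.mk y, rfl⟩

instance : PreservesFiniteLimits (quotFFunctor.{u} n) := (quotFFunctor_exact n).1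

instance : PreservesFiniteColimits (quotFFunctor.{u} n) := (quotFFunctor_exact n).2

end QuotF

end FormalHodge

namespace FormalHodge

open scoped MHS MHSLevel

/-! ### Formal Hodge structures: additive structure and componentwise kernels and cokernels -/

section Factorization

variable {R : Type*} [Ring R] {L M N : Type*} [AddCommGroup L] [AddCommGroup M] [AddCommGroup N]
  [Module R L] [Module R M] [Module R N]

/-- Together with its dual below, this produces the augmentations of kernels and cokernels, over ℤ
for h_et and over ℂ for h^o. -/
theorem exists_comp_eq_of_injective (i : M →ₗ[R] N) (hi : Function.Injective i) (g : L →ₗ[R] N)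
    (h : ∀ x, ∃ y, i y = g x) : ∃ l : L →ₗ[R] M, ∀ x, i (l x) = g x := by
  choose l hl using h
  exact ⟨⟨⟨l, fun x y => hi (by simp only [map_add, hl])⟩,
    fun c x => hi (by simp only [map_smul, hl, RingHom.id_apply])⟩, hl⟩

theorem exists_comp_eq_of_surjective (p : M →ₗ[R] N) (hp : Function.Surjective p) (g : M →ₗ[R] L)
    (h : ∀ x, p x = 0 → g x = 0) : ∃ d : N →ₗ[R] L, ∀ x, d (p x) = g x := by
  have h' (x y : M) (hxy : p x = p y) : g x = g y := by
    rw [← sub_eq_zero, ← map_sub]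
    exact h _ (by rw [map_sub, hxy, sub_self])
  choose s hs using hp
  refine ⟨⟨⟨fun x => g (s x), fun x y => ?_⟩, fun c x => ?_⟩, fun x => h' _ _ (hs _)⟩
  · rw [← map_add]
    exact h' _ _ (by simp only [map_add, hs])
  · rw [RingHom.id_apply, ← map_smul]
    exact h' _ _ (by simp only [map_smul, hs])

end Factorization

theorem VecDiag.add_app_apply {n : ℕ} {V V' : VecDiag.{u} n} (f g : V ⟶ V') (j : Fin n) (x : V.obj j) :
    ((f + g).app j).hom.hom x = (f.app j).hom.hom x + (g.app j).hom.hom x := rfl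

namespace FHS

variable {n : ℕ} [NeZero n]

/-- The maps `π_i : V_i → H_ℂ / F^i` of a formal Hodge structure. -/
noncomputable def proj (A : FHS.{u} n) : A.V ⟶ (quotFFunctor n).obj A.et := A.π

theorem proj_hEt (A : FHS.{u} n) (x : A.et.obj.carrier) :
    (A.proj.app 0).hom.hom (A.hEt x) = Submodule.Quotient.mk ((1 : ℂ) ⊗ₜ[ℤ] x) :=
  A.π_hEt x

theorem Hom.comm_proj {A B : FHS.{u} n} (f : A ⟶ B) :
    f.φ ≫ B.proj = A.proj ≫ (quotFFunctor n).map f.fEt := f.comm_π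

section Preadditive

variable {A B : FHS.{u} n}

instance : Zero (A ⟶ B) where
  zero :=
    { fEt := 0
      fConn := 0
      φ := 0
      comm_et _ := (map_zero B.hEt).symm
      comm_conn _ := (map_zero B.hConn).symm
      comm_π := by
        change 0 ≫ B.proj = A.proj ≫ (quotFFunctor n).map 0
        rw [Functor.map_zero, zero_comp, comp_zero] }

instance : Add (A ⟶ B) where
  add f g :=
    { fEt := f.fEt + g.fEt
      fConn := f.fConn + g.fConn
      φ := f.φ + g.φ
      comm_et x := by
        rw [VecDiag.add_app_apply, f.comm_et, g.comm_et]
        exact (map_add B.hEt _ _).symm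
      comm_conn x := by
        rw [VecDiag.add_app_apply, f.comm_conn, g.comm_conn]
        exact (map_add B.hConn _ _).symm
      comm_π := by
        change (f.φ + g.φ) ≫ B.proj = A.proj ≫ (quotFFunctor n).map (f.fEt + g.fEt)
        rw [Functor.map_add, Preadditive.add_comp, Preadditive.comp_add, f.comm_proj, g.comm_proj] }

instance : Neg (A ⟶ B) where
  neg f :=
    { fEt := -f.fEt
      fConn := -f.fConn
      φ := -f.φ
      comm_et x := by
        change -((f.φ.app 0).hom.hom (A.hEt x)) = _
        rw [f.comm_et]
        exact (map_neg B.hEt _).symm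
      comm_conn x := by
        change -((f.φ.app 0).hom.hom (A.hConn x)) = _
        rw [f.comm_conn]
        exact (map_neg B.hConn _).symm
      comm_π := by
        change (-f.φ) ≫ B.proj = A.proj ≫ (quotFFunctor n).map (-f.fEt)
        rw [Functor.map_neg, Preadditive.neg_comp, Preadditive.comp_neg, f.comm_proj] }

instance : AddCommGroup (A ⟶ B) where
  add_assoc f g h := hom_ext (add_assoc _ _ _) (add_assoc _ _ _) (add_assoc _ _ _)
  zero_add f := hom_ext (zero_add _) (zero_add _) (zero_add _)
  add_zero f := hom_ext (add_zero _) (add_zero _) (add_zero _)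
  add_comm f g := hom_ext (add_comm _ _) (add_comm _ _) (add_comm _ _)
  neg_add_cancel f := hom_ext (neg_add_cancel _) (neg_add_cancel _) (neg_add_cancel _)
  nsmul := nsmulRec
  zsmul := zsmulRec

scoped instance instPreadditive : Preadditive (FHS.{u} n) where
  add_comp _ _ _ _ _ _ := hom_ext (Preadditive.add_comp _ _ _ _ _ _)
    (Preadditive.add_comp _ _ _ _ _ _) (Preadditive.add_comp _ _ _ _ _ _)
  comp_add _ _ _ _ _ _ := hom_ext (Preadditive.comp_add _ _ _ _ _ _)
    (Preadditive.comp_add _ _ _ _ _ _) (Preadditive.comp_add _ _ _ _ _ _)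

end Preadditive

section Components

variable (n)

/-- The étale part of a formal Hodge structure. -/
noncomputable def etFunctor : FHS.{u} n ⥤ MHSLevel.{u} n where
  obj A := A.et
  map f := f.fEt

/-- The connected part of a formal Hodge structure. -/
noncomputable def connFunctor : FHS.{u} n ⥤ FGModuleCat.{u} ℂ where
  obj A := A.conn
  map f := f.fConn

/-- The diagram of vector spaces of a formal Hodge structure. -/
noncomputable def diagFunctor : FHS.{u} n ⥤ VecDiag.{u} n where
  obj A := A.V
  map f := f.φ

/-- The underlying abelian groups of the components of a formal Hodge structure. -/
noncomputable def toAb : Option (Option (Fin n)) → FHS.{u} n ⥤ AddCommGrpCat.{u}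
  | none => etFunctor n ⋙ MHSLevel.toAb n
  | some none => connFunctor n ⋙ vecToAb
  | some (some j) => diagFunctor n ⋙ VecDiag.toAb n j

instance : (etFunctor.{u} n).Additive where
  map_add := rfl

instance (i : Option (Option (Fin n))) : (toAb.{u} n i).Additive :=
  match i with
  | none => { map_add := rfl }
  | some none => { map_add := rfl }
  | some (some _) => { map_add := rfl }

end Components

/-- Compatibility of the inverse components with h_et, h^o and π follows by cancelling the original
isomorphisms. -/
theorem isIso_of_isIso {A B : FHS.{u} n} (f : A ⟶ B) (h₁ : IsIso f.fEt) (h₂ : IsIso f.fConn)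
    (h₃ : IsIso f.φ) : IsIso f := by
  let g : B ⟶ A :=
    { fEt := inv f.fEt
      fConn := inv f.fConn
      φ := inv f.φ
      comm_et x := by
        have key : (f.φ.app 0).hom.hom (A.hEt ((inv f.fEt).hom.toLin x)) = B.hEt x := by
          rw [f.comm_et]
          exact congr_arg B.hEt
            (LinearMap.congr_fun (congr_arg (fun h => h.hom.toLin) (IsIso.inv_hom_id f.fEt)) x)
        rw [← key]
        exact LinearMap.congr_fun (congr_arg (fun h => (h.app 0).hom.hom) (IsIso.hom_inv_id f.φ)) _
      comm_conn x := by
        have key : (f.φ.app 0).hom.hom (A.hConn ((inv f.fConn).hom.hom x)) = B.hConn x := by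
          rw [f.comm_conn]
          exact congr_arg B.hConn
            (LinearMap.congr_fun (congr_arg (fun h => h.hom.hom) (IsIso.inv_hom_id f.fConn)) x)
        rw [← key]
        exact LinearMap.congr_fun (congr_arg (fun h => (h.app 0).hom.hom) (IsIso.hom_inv_id f.φ)) _
      comm_π := by
        change inv f.φ ≫ A.proj = B.proj ≫ (quotFFunctor n).map (inv f.fEt)
        rw [IsIso.inv_comp_eq, ← Category.assoc, f.comm_proj, Category.assoc, ← Functor.map_comp,
          IsIso.hom_inv_id, CategoryTheory.Functor.map_id, Category.comp_id] }
  exact ⟨g, hom_ext (IsIso.hom_inv_id f.fEt) (IsIso.hom_inv_id f.fConn) (IsIso.hom_inv_id f.φ),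
    hom_ext (IsIso.inv_hom_id f.fEt) (IsIso.inv_hom_id f.fConn) (IsIso.inv_hom_id f.φ)⟩

end FHS

end FormalHodge

namespace FormalHodge

open scoped MHS MHSLevel

namespace FHS

variable {n : ℕ} [NeZero n]

/-- The kernel of a morphism of formal Hodge structures exists and is computed componentwise. -/
theorem exists_kernel {A B : FHS.{u} n} (f : A ⟶ B) :
    ∃ (K : FHS.{u} n) (k : K ⟶ A) (w : k ≫ f = 0),
      Nonempty (IsLimit (KernelFork.ofι k w)) ∧ ∀ i, Function.Injective ((toAb n i).map k).hom ∧
        ∀ x, ((toAb n i).map f).hom x = 0 → ∃ y, ((toAb n i).map k).hom y = x := by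
  have hV := VecDiag.detectsExact.{u} n
  have hE := MHSLevel.detectsExact.{u} n
  have hC := vec_detectsExact.{u}
  have hι : Function.Injective (((kernel.ι f.φ).app 0).hom.hom) := hV.kernel_ι_injective 0 f.φ
  have zE (x) : f.fEt.hom.toLin ((kernel.ι f.fEt).hom.toLin x) = 0 :=
    LinearMap.congr_fun (congr_arg (fun h => h.hom.toLin) (kernel.condition f.fEt)) x
  have zC (x) : f.fConn.hom.hom ((kernel.ι f.fConn).hom.hom x) = 0 :=
    LinearMap.congr_fun (congr_arg (fun h => h.hom.hom) (kernel.condition f.fConn)) x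
  obtain ⟨hEt, hEt_spec⟩ := exists_comp_eq_of_injective
    (((kernel.ι f.φ).app 0).hom.hom.restrictScalars ℤ) hι (A.hEt ∘ₗ (kernel.ι f.fEt).hom.toLin)
    (fun x => hV.exists_kernel_ι_eq 0 f.φ (A.hEt ((kernel.ι f.fEt).hom.toLin x))
      ((f.comm_et _).trans (by rw [zE, map_zero]; rfl)))
  obtain ⟨hConn, hConn_spec⟩ := exists_comp_eq_of_injective
    ((kernel.ι f.φ).app 0).hom.hom hι (A.hConn ∘ₗ (kernel.ι f.fConn).hom.hom)
    (fun x => hV.exists_kernel_ι_eq 0 f.φ (A.hConn ((kernel.ι f.fConn).hom.hom x))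
      ((f.comm_conn _).trans (by rw [zC, map_zero]; rfl)))
  -- The map a priori lands in the kernel of the map of Hodge quotients; exactness of H ↦ H_ℂ/F^i
  -- identifies this with the Hodge quotients of the kernel.
  let π : kernel f.φ ⟶ (quotFFunctor n).obj (kernel f.fEt) :=
    kernel.lift ((quotFFunctor n).map f.fEt) (kernel.ι f.φ ≫ A.proj)
      (by rw [Category.assoc, ← f.comm_proj, kernel.condition_assoc, zero_comp]) ≫
      (PreservesKernel.iso (quotFFunctor n) f.fEt).inv
  have hπ : π ≫ (quotFFunctor n).map (kernel.ι f.fEt) = kernel.ι f.φ ≫ A.proj := by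
    simp [π]
  -- By this injectivity the normalization of π ∘ h_et is inherited from A.
  have hQ : Function.Injective (((quotFFunctor n).map (kernel.ι f.fEt)).app 0).hom.hom :=
    (hV.mono_iff ((quotFFunctor n).map (kernel.ι f.fEt))).1 inferInstance 0
  let K : FHS.{u} n :=
    { et := kernel f.fEt
      conn := kernel f.fConn
      V := kernel f.φ
      hEt := hEt
      hConn := hConn
      π := π
      π_hEt := fun x => hQ <| by
        refine (LinearMap.congr_fun (congr_arg (fun h => (h.app 0).hom.hom) hπ) (hEt x)).trans ?_
        refine (congr_arg (A.proj.app 0).hom.hom (hEt_spec x)).trans ?_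
        exact A.proj_hEt _ }
  let k : K ⟶ A :=
    { fEt := kernel.ι f.fEt
      fConn := kernel.ι f.fConn
      φ := kernel.ι f.φ
      comm_et := hEt_spec
      comm_conn := hConn_spec
      comm_π := hπ.symm }
  have w : k ≫ f = 0 :=
    hom_ext (kernel.condition f.fEt) (kernel.condition f.fConn) (kernel.condition f.φ)
  refine ⟨K, k, w, ⟨?_⟩, ?_⟩
  · have z₁ {L : FHS.{u} n} (g : L ⟶ A) (hg : g ≫ f = 0) : g.fEt ≫ f.fEt = 0 :=
      congr_arg Hom.fEt hg
    have z₂ {L : FHS.{u} n} (g : L ⟶ A) (hg : g ≫ f = 0) : g.fConn ≫ f.fConn = 0 :=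
      congr_arg Hom.fConn hg
    have z₃ {L : FHS.{u} n} (g : L ⟶ A) (hg : g ≫ f = 0) : g.φ ≫ f.φ = 0 :=
      congr_arg Hom.φ hg
    refine KernelFork.IsLimit.ofι k w (fun {L} g hg =>
      { fEt := kernel.lift f.fEt g.fEt (z₁ g hg)
        fConn := kernel.lift f.fConn g.fConn (z₂ g hg)
        φ := kernel.lift f.φ g.φ (z₃ g hg)
        comm_et := fun x => hι ?_
        comm_conn := fun x => hι ?_
        comm_π := ?_ }) ?_ ?_
    · refine (LinearMap.congr_fun (congr_arg (fun h => (h.app 0).hom.hom)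
        (kernel.lift_ι f.φ g.φ (z₃ g hg))) (L.hEt x)).trans ((g.comm_et x).trans ?_)
      refine Eq.trans ?_ (hEt_spec _).symm
      exact congr_arg A.hEt (LinearMap.congr_fun (congr_arg (fun h => h.hom.toLin)
        (kernel.lift_ι f.fEt g.fEt (z₁ g hg))) x).symm
    · refine (LinearMap.congr_fun (congr_arg (fun h => (h.app 0).hom.hom)
        (kernel.lift_ι f.φ g.φ (z₃ g hg))) (L.hConn x)).trans ((g.comm_conn x).trans ?_)
      refine Eq.trans ?_ (hConn_spec _).symm
      exact congr_arg A.hConn (LinearMap.congr_fun (congr_arg (fun h => h.hom.hom)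
        (kernel.lift_ι f.fConn g.fConn (z₂ g hg))) x).symm
    · change kernel.lift f.φ g.φ _ ≫ π = L.proj ≫ (quotFFunctor n).map _
      rw [← cancel_mono ((quotFFunctor n).map (kernel.ι f.fEt)), Category.assoc, hπ,
        kernel.lift_ι_assoc, g.comm_proj, Category.assoc, ← Functor.map_comp, kernel.lift_ι]
    · exact fun g hg => hom_ext (kernel.lift_ι _ _ _) (kernel.lift_ι _ _ _) (kernel.lift_ι _ _ _)
    · intro L g hg m hm
      refine hom_ext ?_ ?_ ?_
      · rw [← cancel_mono (kernel.ι f.fEt)]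
        exact (congr_arg Hom.fEt hm).trans (kernel.lift_ι _ _ _).symm
      · rw [← cancel_mono (kernel.ι f.fConn)]
        exact (congr_arg Hom.fConn hm).trans (kernel.lift_ι _ _ _).symm
      · rw [← cancel_mono (kernel.ι f.φ)]
        exact (congr_arg Hom.φ hm).trans (kernel.lift_ι _ _ _).symm
  · rintro (_ | _ | j)
    · exact ⟨hE.kernel_ι_injective () f.fEt, hE.exists_kernel_ι_eq () f.fEt⟩
    · exact ⟨hC.kernel_ι_injective () f.fConn, hC.exists_kernel_ι_eq () f.fConn⟩
    · exact ⟨hV.kernel_ι_injective j f.φ, hV.exists_kernel_ι_eq j f.φ⟩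

/-- The cokernel of a morphism of formal Hodge structures exists and is computed componentwise. -/
theorem exists_cokernel {A B : FHS.{u} n} (f : A ⟶ B) :
    ∃ (Q : FHS.{u} n) (q : B ⟶ Q) (w : f ≫ q = 0),
      Nonempty (IsColimit (CokernelCofork.ofπ q w)) ∧
        ∀ i, Function.Surjective ((toAb n i).map q).hom ∧
          ∀ y, ((toAb n i).map q).hom y = 0 → ∃ x, ((toAb n i).map f).hom x = y := by
  have hV := VecDiag.detectsExact.{u} n
  have hE := MHSLevel.detectsExact.{u} n
  have hC := vec_detectsExact.{u}
  have sE : Function.Surjective (cokernel.π f.fEt).hom.toLin := hE.cokernel_π_surjective () f.fEt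
  have sC : Function.Surjective (cokernel.π f.fConn).hom.hom :=
    hC.cokernel_π_surjective () f.fConn
  have zV (x) : ((cokernel.π f.φ).app 0).hom.hom ((f.φ.app 0).hom.hom x) = 0 :=
    LinearMap.congr_fun (congr_arg (fun h => (h.app 0).hom.hom) (cokernel.condition f.φ)) x
  -- The augmentation descends because f_et x has augmentation φ (h_et x), which dies in the
  -- cokernel of φ.
  obtain ⟨hEt, hEt_spec⟩ := exists_comp_eq_of_surjective (cokernel.π f.fEt).hom.toLin sE
    (((cokernel.π f.φ).app 0).hom.hom.restrictScalars ℤ ∘ₗ B.hEt) (fun y hy => by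
      obtain ⟨x, rfl⟩ := hE.exists_eq_of_cokernel_π_eq_zero () f.fEt y hy
      exact (congr_arg _ (f.comm_et x).symm).trans (zV _))
  obtain ⟨hConn, hConn_spec⟩ := exists_comp_eq_of_surjective (cokernel.π f.fConn).hom.hom sC
    (((cokernel.π f.φ).app 0).hom.hom ∘ₗ B.hConn) (fun y hy => by
      obtain ⟨x, rfl⟩ := hC.exists_eq_of_cokernel_π_eq_zero () f.fConn y hy
      exact (congr_arg _ (f.comm_conn x).symm).trans (zV _))
  let π : cokernel f.φ ⟶ (quotFFunctor n).obj (cokernel f.fEt) :=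
    cokernel.desc f.φ (B.proj ≫ (quotFFunctor n).map (cokernel.π f.fEt))
      (by rw [reassoc_of% f.comm_proj, ← Functor.map_comp, cokernel.condition, Functor.map_zero,
        comp_zero])
  have hπ : cokernel.π f.φ ≫ π = B.proj ≫ (quotFFunctor n).map (cokernel.π f.fEt) :=
    cokernel.π_desc _ _ _
  let Q : FHS.{u} n :=
    { et := cokernel f.fEt
      conn := cokernel f.fConn
      V := cokernel f.φ
      hEt := hEt
      hConn := hConn
      π := π
      π_hEt := fun x => by
        obtain ⟨x, rfl⟩ := sE x
        rw [hEt_spec]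
        refine (LinearMap.congr_fun (congr_arg (fun h => (h.app 0).hom.hom) hπ) (B.hEt x)).trans ?_
        exact congr_arg (((quotFFunctor n).map (cokernel.π f.fEt)).app 0).hom.hom (B.proj_hEt x) }
  let q : B ⟶ Q :=
    { fEt := cokernel.π f.fEt
      fConn := cokernel.π f.fConn
      φ := cokernel.π f.φ
      comm_et := fun x => (hEt_spec x).symm
      comm_conn := fun x => (hConn_spec x).symm
      comm_π := hπ }
  have w : f ≫ q = 0 :=
    hom_ext (cokernel.condition f.fEt) (cokernel.condition f.fConn) (cokernel.condition f.φ)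
  refine ⟨Q, q, w, ⟨?_⟩, ?_⟩
  · have z₁ {L : FHS.{u} n} (g : B ⟶ L) (hg : f ≫ g = 0) : f.fEt ≫ g.fEt = 0 :=
      congr_arg Hom.fEt hg
    have z₂ {L : FHS.{u} n} (g : B ⟶ L) (hg : f ≫ g = 0) : f.fConn ≫ g.fConn = 0 :=
      congr_arg Hom.fConn hg
    have z₃ {L : FHS.{u} n} (g : B ⟶ L) (hg : f ≫ g = 0) : f.φ ≫ g.φ = 0 :=
      congr_arg Hom.φ hg
    refine CokernelCofork.IsColimit.ofπ q w (fun {L} g hg =>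
      { fEt := cokernel.desc f.fEt g.fEt (z₁ g hg)
        fConn := cokernel.desc f.fConn g.fConn (z₂ g hg)
        φ := cokernel.desc f.φ g.φ (z₃ g hg)
        comm_et := fun x => ?_
        comm_conn := fun x => ?_
        comm_π := ?_ }) ?_ ?_
    · obtain ⟨x, rfl⟩ := sE x
      refine (congr_arg _ (hEt_spec x)).trans ?_
      refine (LinearMap.congr_fun (congr_arg (fun h => (h.app 0).hom.hom)
        (cokernel.π_desc f.φ g.φ (z₃ g hg))) (B.hEt x)).trans ((g.comm_et x).trans ?_)
      exact congr_arg L.hEt (LinearMap.congr_fun (congr_arg (fun h => h.hom.toLin)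
        (cokernel.π_desc f.fEt g.fEt (z₁ g hg))) x).symm
    · obtain ⟨x, rfl⟩ := sC x
      refine (congr_arg _ (hConn_spec x)).trans ?_
      refine (LinearMap.congr_fun (congr_arg (fun h => (h.app 0).hom.hom)
        (cokernel.π_desc f.φ g.φ (z₃ g hg))) (B.hConn x)).trans ((g.comm_conn x).trans ?_)
      exact congr_arg L.hConn (LinearMap.congr_fun (congr_arg (fun h => h.hom.hom)
        (cokernel.π_desc f.fConn g.fConn (z₂ g hg))) x).symm
    · change cokernel.desc f.φ g.φ _ ≫ L.proj = π ≫ (quotFFunctor n).map _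
      rw [← cancel_epi (cokernel.π f.φ), reassoc_of% hπ, cokernel.π_desc_assoc, g.comm_proj,
        ← Functor.map_comp, cokernel.π_desc]
    · exact fun g hg =>
        hom_ext (cokernel.π_desc _ _ _) (cokernel.π_desc _ _ _) (cokernel.π_desc _ _ _)
    · intro L g hg m hm
      refine hom_ext ?_ ?_ ?_
      · rw [← cancel_epi (cokernel.π f.fEt)]
        exact (congr_arg Hom.fEt hm).trans (cokernel.π_desc _ _ _).symm
      · rw [← cancel_epi (cokernel.π f.fConn)]
        exact (congr_arg Hom.fConn hm).trans (cokernel.π_desc _ _ _).symm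
      · rw [← cancel_epi (cokernel.π f.φ)]
        exact (congr_arg Hom.φ hm).trans (cokernel.π_desc _ _ _).symm
  · rintro (_ | _ | j)
    · exact ⟨sE, hE.exists_eq_of_cokernel_π_eq_zero () f.fEt⟩
    · exact ⟨sC, hC.exists_eq_of_cokernel_π_eq_zero () f.fConn⟩
    · exact ⟨hV.cokernel_π_surjective j f.φ, hV.exists_eq_of_cokernel_π_eq_zero j f.φ⟩

theorem detectsAbelian : DetectsAbelian (toAb.{u} n) where
  isIso_of_bijective f hf := isIso_of_isIso f
    ((MHSLevel.detectsExact n).isIso_of_bijective _ fun _ => hf none)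
    (vec_detectsExact.isIso_of_bijective _ fun _ => hf (some none))
    ((VecDiag.detectsExact n).isIso_of_bijective _ fun j => hf (some (some j)))
  exists_kernel := exists_kernel
  exists_cokernel := exists_cokernel

end FHS

end FormalHodge

namespace FormalHodge

open scoped MHS MHSLevel FHS

/-! ### Sums of formal Hodge structures and the abelian structure -/

theorem DetectsExact.shortExact {C I : Type*} [Category* C] [Abelian C]
    {G : I → C ⥤ AddCommGrpCat.{u}} (hG : DetectsExact G) {S : ShortComplex C} (hS : S.ShortExact)
    (i : I) : Function.Injective ((G i).map S.f).hom ∧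
      (∀ x, ((G i).map S.g).hom x = 0 → ∃ y, ((G i).map S.f).hom y = x) ∧
      Function.Surjective ((G i).map S.g).hom :=
  ⟨(hG.mono_iff S.f).1 hS.mono_f i, (hG.exact_iff S).1 hS.exact i, (hG.epi_iff S.g).1 hS.epi_g i⟩

theorem VecDiag.comp_apply_of_eq {n : ℕ} {V V' V'' : VecDiag.{u} n} {f : V ⟶ V'} {g : V' ⟶ V''}
    {h : V ⟶ V''} (w : f ≫ g = h) (j : Fin n) (x : V.obj j) :
    (g.app j).hom.hom ((f.app j).hom.hom x) = (h.app j).hom.hom x := by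
  rw [← w]; rfl

theorem MHSLevel.comp_apply_of_eq {n : ℕ} {H K L : MHSLevel.{u} n} {f : H ⟶ K} {g : K ⟶ L}
    {h : H ⟶ L} (w : f ≫ g = h) (x : H.obj.carrier) :
    g.hom.toLin (f.hom.toLin x) = h.hom.toLin x := by
  rw [← w]; rfl

theorem vec_comp_apply_of_eq {V V' V'' : FGModuleCat.{u} ℂ} {f : V ⟶ V'} {g : V' ⟶ V''}
    {h : V ⟶ V''} (w : f ≫ g = h) (x : V) : g.hom.hom (f.hom.hom x) = h.hom.hom x := by
  rw [← w]; rfl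

namespace FHS

variable {n : ℕ} [NeZero n]

/-- The direct sum of two formal Hodge structures. -/
noncomputable def prod (A B : FHS.{u} n) : FHS.{u} n where
  et := A.et ⊞ B.et
  conn := A.conn ⊞ B.conn
  V := A.V ⊞ B.V
  hEt := ((biprod.inl : A.V ⟶ A.V ⊞ B.V).app 0).hom.hom.restrictScalars ℤ ∘ₗ A.hEt ∘ₗ
      (biprod.fst : A.et ⊞ B.et ⟶ A.et).hom.toLin +
    ((biprod.inr : B.V ⟶ A.V ⊞ B.V).app 0).hom.hom.restrictScalars ℤ ∘ₗ B.hEt ∘ₗ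
      (biprod.snd : A.et ⊞ B.et ⟶ B.et).hom.toLin
  hConn := ((biprod.inl : A.V ⟶ A.V ⊞ B.V).app 0).hom.hom ∘ₗ A.hConn ∘ₗ
      (biprod.fst : A.conn ⊞ B.conn ⟶ A.conn).hom.hom +
    ((biprod.inr : B.V ⟶ A.V ⊞ B.V).app 0).hom.hom ∘ₗ B.hConn ∘ₗ
      (biprod.snd : A.conn ⊞ B.conn ⟶ B.conn).hom.hom
  π := (biprod.desc (A.proj ≫ (quotFFunctor n).map biprod.inl)
    (B.proj ≫ (quotFFunctor n).map biprod.inr) : A.V ⊞ B.V ⟶ (quotFFunctor n).obj (A.et ⊞ B.et))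
  π_hEt x := by
    change ((biprod.desc (A.proj ≫ (quotFFunctor n).map biprod.inl)
      (B.proj ≫ (quotFFunctor n).map biprod.inr)).app 0).hom.hom
      (((biprod.inl : A.V ⟶ A.V ⊞ B.V).app 0).hom.hom (A.hEt
        ((biprod.fst : A.et ⊞ B.et ⟶ A.et).hom.toLin x)) +
      ((biprod.inr : B.V ⟶ A.V ⊞ B.V).app 0).hom.hom (B.hEt
        ((biprod.snd : A.et ⊞ B.et ⟶ B.et).hom.toLin x))) = _
    rw [map_add, VecDiag.comp_apply_of_eq (biprod.inl_desc _ _),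
      VecDiag.comp_apply_of_eq (biprod.inr_desc _ _)]
    change (((quotFFunctor n).map biprod.inl).app 0).hom.hom ((A.proj.app 0).hom.hom _) +
      (((quotFFunctor n).map biprod.inr).app 0).hom.hom ((B.proj.app 0).hom.hom _) = _
    rw [proj_hEt, proj_hEt]
    have total := LinearMap.congr_fun (congr_arg (fun h => h.hom.toLin)
      (biprod.total (X := A.et) (Y := B.et))) x
    change Submodule.Quotient.mk ((1 : ℂ) ⊗ₜ[ℤ] ((biprod.inl : A.et ⟶ A.et ⊞ B.et).hom.toLin
        ((biprod.fst : A.et ⊞ B.et ⟶ A.et).hom.toLin x)) +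
      (1 : ℂ) ⊗ₜ[ℤ] ((biprod.inr : B.et ⟶ A.et ⊞ B.et).hom.toLin
        ((biprod.snd : A.et ⊞ B.et ⟶ B.et).hom.toLin x))) = _
    rw [← TensorProduct.tmul_add]
    exact congr_arg (fun y => Submodule.Quotient.mk ((1 : ℂ) ⊗ₜ[ℤ] y)) total

/-- The projections of a direct sum of formal Hodge structures. -/
noncomputable def prodFst (A B : FHS.{u} n) : prod A B ⟶ A where
  fEt := biprod.fst
  fConn := biprod.fst
  φ := biprod.fst
  comm_et x := by
    refine (map_add _ _ _).trans ?_
    refine (congr_arg₂ _ (VecDiag.comp_apply_of_eq biprod.inl_fst 0 _)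
      (VecDiag.comp_apply_of_eq biprod.inr_fst 0 _)).trans ?_
    exact add_zero _
  comm_conn x := by
    refine (map_add _ _ _).trans ?_
    refine (congr_arg₂ _ (VecDiag.comp_apply_of_eq biprod.inl_fst 0 _)
      (VecDiag.comp_apply_of_eq biprod.inr_fst 0 _)).trans ?_
    exact add_zero _
  comm_π := by
    change biprod.fst ≫ A.proj = biprod.desc (A.proj ≫ (quotFFunctor n).map biprod.inl)
      (B.proj ≫ (quotFFunctor n).map biprod.inr) ≫ (quotFFunctor n).map biprod.fst
    refine biprod.hom_ext' _ _ ?_ ?_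
    · rw [biprod.inl_fst_assoc, biprod.inl_desc_assoc, Category.assoc, ← Functor.map_comp,
        biprod.inl_fst, CategoryTheory.Functor.map_id, Category.comp_id]
    · rw [biprod.inr_fst_assoc, biprod.inr_desc_assoc, Category.assoc, ← Functor.map_comp,
        biprod.inr_fst, Functor.map_zero, zero_comp, comp_zero]

/-- The second projection. -/
noncomputable def prodSnd (A B : FHS.{u} n) : prod A B ⟶ B where
  fEt := biprod.snd
  fConn := biprod.snd
  φ := biprod.snd
  comm_et x := by
    refine (map_add _ _ _).trans ?_
    refine (congr_arg₂ _ (VecDiag.comp_apply_of_eq biprod.inl_snd 0 _)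
      (VecDiag.comp_apply_of_eq biprod.inr_snd 0 _)).trans ?_
    exact zero_add _
  comm_conn x := by
    refine (map_add _ _ _).trans ?_
    refine (congr_arg₂ _ (VecDiag.comp_apply_of_eq biprod.inl_snd 0 _)
      (VecDiag.comp_apply_of_eq biprod.inr_snd 0 _)).trans ?_
    exact zero_add _
  comm_π := by
    change biprod.snd ≫ B.proj = biprod.desc (A.proj ≫ (quotFFunctor n).map biprod.inl)
      (B.proj ≫ (quotFFunctor n).map biprod.inr) ≫ (quotFFunctor n).map biprod.snd
    refine biprod.hom_ext' _ _ ?_ ?_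
    · rw [biprod.inl_snd_assoc, biprod.inl_desc_assoc, Category.assoc, ← Functor.map_comp,
        biprod.inl_snd, Functor.map_zero, zero_comp, comp_zero]
    · rw [biprod.inr_snd_assoc, biprod.inr_desc_assoc, Category.assoc, ← Functor.map_comp,
        biprod.inr_snd, CategoryTheory.Functor.map_id, Category.comp_id]

/-- The morphism to a direct sum with given components. -/
noncomputable def prodLift {A B L : FHS.{u} n} (f : L ⟶ A) (g : L ⟶ B) : L ⟶ prod A B where
  fEt := biprod.lift f.fEt g.fEt
  fConn := biprod.lift f.fConn g.fConn
  φ := biprod.lift f.φ g.φ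
  comm_et x := by
    rw [biprod.lift_eq (f := f.φ)]
    refine (congr_arg₂ (fun a b => ((biprod.inl : A.V ⟶ A.V ⊞ B.V).app 0).hom.hom a +
      ((biprod.inr : B.V ⟶ A.V ⊞ B.V).app 0).hom.hom b)
      (f.comm_et x) (g.comm_et x)).trans ?_
    exact (congr_arg₂ (fun a b => ((biprod.inl : A.V ⟶ A.V ⊞ B.V).app 0).hom.hom (A.hEt a) +
      ((biprod.inr : B.V ⟶ A.V ⊞ B.V).app 0).hom.hom (B.hEt b)) (MHSLevel.comp_apply_of_eq (biprod.lift_fst _ _) x)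
      (MHSLevel.comp_apply_of_eq (biprod.lift_snd _ _) x)).symm
  comm_conn x := by
    rw [biprod.lift_eq (f := f.φ)]
    refine (congr_arg₂ (fun a b => ((biprod.inl : A.V ⟶ A.V ⊞ B.V).app 0).hom.hom a +
      ((biprod.inr : B.V ⟶ A.V ⊞ B.V).app 0).hom.hom b)
      (f.comm_conn x) (g.comm_conn x)).trans ?_
    exact (congr_arg₂ (fun a b => ((biprod.inl : A.V ⟶ A.V ⊞ B.V).app 0).hom.hom (A.hConn a) +
      ((biprod.inr : B.V ⟶ A.V ⊞ B.V).app 0).hom.hom (B.hConn b)) (vec_comp_apply_of_eq (biprod.lift_fst _ _) x)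
      (vec_comp_apply_of_eq (biprod.lift_snd _ _) x)).symm
  comm_π := by
    change biprod.lift f.φ g.φ ≫ biprod.desc (A.proj ≫ (quotFFunctor n).map biprod.inl)
      (B.proj ≫ (quotFFunctor n).map biprod.inr) = L.proj ≫ (quotFFunctor n).map _
    rw [biprod.lift_desc, reassoc_of% f.comm_proj, reassoc_of% g.comm_proj, ← Functor.map_comp,
      ← Functor.map_comp, ← Preadditive.comp_add, ← Functor.map_add, biprod.lift_eq]

variable (n)

open scoped ZeroObject in
instance : HasZeroObject (FHS.{u} n) :=
  ⟨⟨(mhsToFHS n).obj 0, (IsZero.iff_id_eq_zero _).2 (by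
    rw [← (mhsToFHS n).map_id, (isZero_zero (MHSLevel.{u} n)).eq_of_src (𝟙 0) 0]
    exact hom_ext rfl rfl ((quotFFunctor n).map_zero _ _))⟩⟩

instance : HasBinaryProducts (FHS.{u} n) := by
  have (A B : FHS.{u} n) : HasLimit (pair A B) :=
    ⟨⟨⟨BinaryFan.mk (prodFst A B) (prodSnd A B), BinaryFan.IsLimit.mk _ prodLift
      (fun _ _ => hom_ext (biprod.lift_fst _ _) (biprod.lift_fst _ _) (biprod.lift_fst _ _))
      (fun _ _ => hom_ext (biprod.lift_snd _ _) (biprod.lift_snd _ _) (biprod.lift_snd _ _))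
      (fun f g m hf hg => by
        subst hf hg
        exact hom_ext
          (biprod.hom_ext _ _ (biprod.lift_fst _ _).symm (biprod.lift_snd _ _).symm)
          (biprod.hom_ext _ _ (biprod.lift_fst _ _).symm (biprod.lift_snd _ _).symm)
          (biprod.hom_ext _ _ (biprod.lift_fst _ _).symm (biprod.lift_snd _ _).symm))⟩⟩⟩
  exact hasBinaryProducts_of_hasLimit_pair _

instance : HasFiniteProducts (FHS.{u} n) := hasFiniteProducts_of_has_binary_and_terminal

noncomputable scoped instance instAbelian : Abelian (FHS.{u} n) := detectsAbelian.abelian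

theorem detectsExact : DetectsExact (toAb.{u} n) := detectsAbelian.detectsExact

end FHS

end FormalHodge

namespace FormalHodge

open scoped MHS MHSLevel FHS

/-! ### The exact functors and natural transformations of the two zigzags -/

theorem MHSLevel.isZero_zero (n : ℕ) : IsZero
    (⟨MHS.zero, MHS.levelLE_zero n⟩ : MHSLevel.{u} n) :=
  (IsZero.iff_id_eq_zero _).2 (by
    refine ObjectProperty.hom_ext _ (MHS.hom_ext (LinearMap.ext fun x => ?_))
    exact Subsingleton.elim (α := PUnit) _ _)

namespace FHS

variable (n : ℕ) [NeZero n]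

theorem etFunctor_exact :
    PreservesFiniteLimits (etFunctor.{u} n) ∧ PreservesFiniteColimits (etFunctor.{u} n) :=
  preservesFiniteLimits_and_colimits (MHSLevel.detectsExact n) _
    fun _ hS _ => (detectsExact n).shortExact hS none

/-- The functor which forgets the connected part of a formal Hodge structure. -/
noncomputable def dropConn : FHS.{u} n ⥤ FHS.{u} n where
  obj A := { A with
    conn := FGModuleCat.of ℂ PUnit
    hConn := 0 }
  map f :=
    { fEt := f.fEt
      fConn := 𝟙 _
      φ := f.φ
      comm_et := f.comm_et
      comm_conn _ := map_zero _
      comm_π := f.comm_π }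

instance : (dropConn.{u} n).Additive where
  map_add := rfl

theorem dropConn_exact :
    PreservesFiniteLimits (dropConn.{u} n) ∧ PreservesFiniteColimits (dropConn.{u} n) := by
  refine preservesFiniteLimits_and_colimits (detectsExact n) _ fun S hS i => ?_
  match i with
  | none => exact (detectsExact n).shortExact hS none
  | some none =>
    exact ⟨fun _ _ _ => rfl, fun _ _ => ⟨PUnit.unit, rfl⟩, fun _ => ⟨PUnit.unit, rfl⟩⟩
  | some (some j) => exact (detectsExact n).shortExact hS (some (some j))

/-- The inclusion of a formal Hodge structure without its connected part. -/
noncomputable def dropConnι : dropConn.{u} n ⟶ 𝟭 (FHS.{u} n) where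
  app A :=
    { fEt := 𝟙 A.et
      fConn := 0
      φ := 𝟙 A.V
      comm_et _ := rfl
      comm_conn _ := (map_zero A.hConn).symm
      comm_π := by
        change 𝟙 _ ≫ A.proj = A.proj ≫ (quotFFunctor n).map (𝟙 _)
        rw [CategoryTheory.Functor.map_id, Category.id_comp, Category.comp_id] }
  naturality A B f := hom_ext ((Category.comp_id f.fEt).trans (Category.id_comp f.fEt).symm)
    (comp_zero.trans zero_comp.symm) ((Category.comp_id f.φ).trans (Category.id_comp f.φ).symm)

/-- The projection `(H_et, 0, V) → (H_et, 0, H_ℂ / F)`. -/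
noncomputable def dropConnProj : dropConn.{u} n ⟶ etFunctor n ⋙ mhsToFHS n where
  app A :=
    { fEt := 𝟙 A.et
      fConn := 𝟙 _
      φ := A.proj
      comm_et := A.proj_hEt
      comm_conn _ := map_zero _
      comm_π := by
        change A.proj ≫ 𝟙 _ = A.proj ≫ (quotFFunctor n).map (𝟙 _)
        rw [CategoryTheory.Functor.map_id] }
  naturality A B f := hom_ext ((Category.comp_id f.fEt).trans (Category.id_comp f.fEt).symm)
    rfl f.comm_proj

/-- The functor `(H, V) ↦ Ker π`. -/
noncomputable def kerProj : FHS.{u} n ⥤ VecDiag.{u} n where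
  obj A := kernel A.proj
  map {A B} f := kernel.map A.proj B.proj f.φ ((quotFFunctor n).map f.fEt) f.comm_proj.symm
  map_id A := by
    rw [← cancel_mono (kernel.ι A.proj), kernel.lift_ι, Category.id_comp]
    exact Category.comp_id _
  map_comp {A B C} f g := by
    rw [← cancel_mono (kernel.ι C.proj), kernel.lift_ι, Category.assoc, kernel.lift_ι,
      kernel.lift_ι_assoc, Category.assoc]
    rfl

variable {n}

theorem kerProj_map_ι {A B : FHS.{u} n} (f : A ⟶ B) :
    (kerProj n).map f ≫ kernel.ι B.proj = kernel.ι A.proj ≫ f.φ := kernel.lift_ι _ _ _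

instance : (kerProj.{u} n).Additive where
  map_add {A B f g} := by
    refine (cancel_mono (kernel.ι B.proj)).1 ((kerProj_map_ι (f + g)).trans ?_)
    refine (Preadditive.comp_add _ _ _ (kernel.ι A.proj) f.φ g.φ).trans ?_
    exact (congr_arg₂ (· + ·) (kerProj_map_ι f).symm (kerProj_map_ι g).symm).trans
      (Preadditive.add_comp _ _ _ _ _ _).symm

/-- At V_n, the element z • h_et x maps to the class of z ⊗ x, and such classes generate the target.
The other components follow since H_ℂ/F^n → H_ℂ/F^i is onto. -/
theorem proj_surjective (A : FHS.{u} n) (j : Fin n) :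
    Function.Surjective (A.proj.app j).hom.hom := by
  have h₀ : Function.Surjective (A.proj.app 0).hom.hom := by
    intro x
    obtain ⟨x, rfl⟩ := Submodule.mkQ_surjective _ x
    induction x using TensorProduct.induction_on with
    | zero => exact ⟨0, (map_zero _).trans (map_zero _).symm⟩
    | tmul z x =>
      refine ⟨z • A.hEt x, ?_⟩
      rw [map_smul, proj_hEt]
      change Submodule.Quotient.mk (z • (1 : ℂ) ⊗ₜ[ℤ] x) = Submodule.Quotient.mk (z ⊗ₜ[ℤ] x)
      rw [TensorProduct.smul_tmul', smul_eq_mul, mul_one]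
    | add x y hx hy =>
      obtain ⟨a, ha⟩ := hx
      obtain ⟨b, hb⟩ := hy
      exact ⟨a + b, by rw [map_add, ha, hb]; rfl⟩
  have hj : (0 : Fin n) ⟶ j := homOfLE (Fin.zero_le _)
  intro x
  obtain ⟨x, rfl⟩ := Submodule.mkQ_surjective _ x
  obtain ⟨y, hy⟩ := h₀ (Submodule.Quotient.mk x)
  refine ⟨(A.V.map hj).hom.hom y, ?_⟩
  refine (LinearMap.congr_fun (congr_arg (fun h => h.hom.hom) (A.proj.naturality hj)) y).trans ?_
  exact congr_arg (((quotFFunctor n).obj A.et).map hj).hom.hom hy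

variable (n)

/-- A snake-lemma chase between the exact sequences of the V_i and of the H_ℂ/F^i; the connecting
obstruction to right exactness vanishes because π is surjective. -/
theorem kerProj_exact :
    PreservesFiniteLimits (kerProj.{u} n) ∧ PreservesFiniteColimits (kerProj.{u} n) := by
  have hV := VecDiag.detectsExact.{u} n
  refine preservesFiniteLimits_and_colimits hV _ fun S hS j => ?_
  obtain ⟨_, _⟩ := etFunctor_exact.{u} n
  obtain ⟨hf, hfg, hg⟩ := (detectsExact n).shortExact hS (some (some j))
  obtain ⟨hf', hfg', -⟩ := hV.shortExact (hS.map_of_exact (etFunctor n ⋙ quotFFunctor n)) j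
  have hι (A : FHS.{u} n) : Function.Injective ((kernel.ι A.proj).app j).hom.hom :=
    hV.kernel_ι_injective j A.proj
  have hz (A : FHS.{u} n) (x) :
      (A.proj.app j).hom.hom (((kernel.ι A.proj).app j).hom.hom x) = 0 :=
    VecDiag.comp_apply_of_eq (kernel.condition A.proj) j x
  have hm {A B : FHS.{u} n} (f : A ⟶ B) (x) :
      ((kernel.ι B.proj).app j).hom.hom ((((kerProj n).map f).app j).hom.hom x) =
        (f.φ.app j).hom.hom (((kernel.ι A.proj).app j).hom.hom x) :=
    VecDiag.comp_apply_of_eq (kerProj_map_ι f) j x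
  have hc {A B : FHS.{u} n} (f : A ⟶ B) (x) : (B.proj.app j).hom.hom ((f.φ.app j).hom.hom x) =
      (((quotFFunctor n).map f.fEt).app j).hom.hom ((A.proj.app j).hom.hom x) :=
    VecDiag.comp_apply_of_eq f.comm_proj j x
  refine ⟨?_, ?_, ?_⟩
  · intro x y hxy
    refine hι _ (hf ?_)
    refine (hm S.f x).symm.trans (Eq.trans ?_ (hm S.f y))
    exact congr_arg ((kernel.ι S.X₂.proj).app j).hom.hom hxy
  · intro x hx
    obtain ⟨y, hy⟩ := hfg (((kernel.ι S.X₂.proj).app j).hom.hom x)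
      ((hm S.g x).symm.trans ((congr_arg ((kernel.ι S.X₃.proj).app j).hom.hom hx).trans
        (map_zero _)))
    -- Injectivity of the first map of Hodge quotients forces the lift y into the kernel of π.
    have hy0 : (S.X₁.proj.app j).hom.hom y = 0 := hf' <| by
      refine (hc S.f y).symm.trans (Eq.trans ?_ (map_zero _).symm)
      exact (congr_arg (S.X₂.proj.app j).hom.hom hy).trans (hz _ _)
    obtain ⟨z, hz⟩ := hV.exists_kernel_ι_eq j S.X₁.proj y hy0
    refine ⟨z, hι _ ?_⟩
    refine (hm S.f z).trans (Eq.trans ?_ hy)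
    exact congr_arg (S.f.φ.app j).hom.hom hz
  · intro x
    obtain ⟨(y : S.X₂.V.obj j), hy⟩ := hg (((kernel.ι S.X₃.proj).app j).hom.hom x)
    obtain ⟨a, ha⟩ := hfg' ((S.X₂.proj.app j).hom.hom y)
      ((hc S.g y).symm.trans ((congr_arg (S.X₃.proj.app j).hom.hom hy).trans (hz _ _)))
    -- Surjectivity of π on the subobject supplies the correction b that moves y into the kernel of
    -- π without changing its image.
    obtain ⟨b, rfl⟩ := S.X₁.proj_surjective j a
    obtain ⟨z, hz'⟩ := hV.exists_kernel_ι_eq j S.X₂.proj (y - (S.f.φ.app j).hom.hom b)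
      ((map_sub (S.X₂.proj.app j).hom.hom _ _).trans
        (sub_eq_zero.2 (ha.symm.trans (hc S.f b).symm)))
    refine ⟨z, hι _ ?_⟩
    refine (hm S.g z).trans ?_
    refine (congr_arg (S.g.φ.app j).hom.hom hz').trans ?_
    refine (map_sub (S.g.φ.app j).hom.hom _ _).trans ?_
    have h0 : (S.g.φ.app j).hom.hom ((S.f.φ.app j).hom.hom b) = 0 :=
      VecDiag.comp_apply_of_eq (congr_arg Hom.φ S.zero) j b
    rw [h0, sub_zero]
    exact hy

/-- The inclusion `(0, Ker π) → (H, V)`. -/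
noncomputable def kerProjι : kerProj.{u} n ⋙ vecToFHS n ⟶ 𝟭 (FHS.{u} n) where
  app A :=
    { fEt := 0
      fConn := 0
      φ := kernel.ι A.proj
      comm_et _ := (map_zero _).trans (map_zero A.hEt).symm
      comm_conn _ := (map_zero _).trans (map_zero A.hConn).symm
      comm_π := (kernel.condition A.proj).trans zero_comp.symm }
  naturality _ _ f := hom_ext (comp_zero.trans zero_comp.symm) (comp_zero.trans zero_comp.symm)
    (kerProj_map_ι f)

theorem isIso_kernel_ι_proj_vecToFHS (V : VecDiag.{u} n) :
    IsIso (kernel.ι ((vecToFHS n).obj V).proj) := by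
  rw [show ((vecToFHS n).obj V).proj = 0 from rfl]
  infer_instance

/-- The identification of the kernel of `π` for `(0, V)` with `V`. -/
noncomputable def vecToFHSCompKerProj : vecToFHS.{u} n ⋙ kerProj n ≅ 𝟭 (VecDiag.{u} n) :=
  NatIso.ofComponents (fun V =>
      @asIso _ _ _ _ (kernel.ι ((vecToFHS n).obj V).proj) (isIso_kernel_ι_proj_vecToFHS n V))
    (fun f => kerProj_map_ι ((vecToFHS n).map f))

end FHS

variable (n : ℕ) [NeZero n]

instance : (mhsToFHS.{u} n).Additive where
  map_add {_ _ _ _} := FHS.hom_ext rfl rfl ((quotFFunctor n).map_add)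

theorem mhsToFHS_exact :
    PreservesFiniteLimits (mhsToFHS.{u} n) ∧ PreservesFiniteColimits (mhsToFHS.{u} n) := by
  refine preservesFiniteLimits_and_colimits (FHS.detectsExact n) _ fun S hS i => ?_
  match i with
  | none => exact (MHSLevel.detectsExact n).shortExact hS ()
  | some none =>
    exact ⟨fun _ _ _ => rfl, fun _ _ => ⟨PUnit.unit, rfl⟩, fun _ => ⟨PUnit.unit, rfl⟩⟩
  | some (some j) =>
    exact (VecDiag.detectsExact n).shortExact (hS.map_of_exact (quotFFunctor n)) j

instance : (vecToFHS.{u} n).Additive where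
  map_add {_ _ _ _} := FHS.hom_ext ((MHSLevel.isZero_zero n).eq_of_src _ _) rfl rfl

theorem vecToFHS_exact :
    PreservesFiniteLimits (vecToFHS.{u} n) ∧ PreservesFiniteColimits (vecToFHS.{u} n) := by
  refine preservesFiniteLimits_and_colimits (FHS.detectsExact n) _ fun S hS i => ?_
  match i with
  | none =>
    exact ⟨fun _ _ _ => rfl, fun _ _ => ⟨PUnit.unit, rfl⟩, fun _ => ⟨PUnit.unit, rfl⟩⟩
  | some none =>
    exact ⟨fun _ _ _ => rfl, fun _ _ => ⟨PUnit.unit, rfl⟩, fun _ => ⟨PUnit.unit, rfl⟩⟩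
  | some (some j) => exact (VecDiag.detectsExact n).shortExact hS j

theorem dropConnι_app_mhsToFHS (H : MHSLevel.{u} n) :
    (FHS.dropConnι n).app ((mhsToFHS n).obj H) = 𝟙 ((mhsToFHS n).obj H) :=
  FHS.hom_ext rfl rfl rfl

theorem dropConnProj_app_mhsToFHS (H : MHSLevel.{u} n) :
    (FHS.dropConnProj n).app ((mhsToFHS n).obj H) = 𝟙 ((mhsToFHS n).obj H) :=
  FHS.hom_ext rfl rfl rfl

theorem map_vecToFHSCompKerProj (V : VecDiag.{u} n) :
    (vecToFHS n).map ((FHS.vecToFHSCompKerProj n).hom.app V) =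
      (FHS.kerProjι n).app ((vecToFHS n).obj V) :=
  FHS.hom_ext ((MHSLevel.isZero_zero n).eq_of_src _ _) rfl rfl

theorem isIso_dropConnι_app_mhsToFHS (H : MHSLevel.{u} n) :
    IsIso ((FHS.dropConnι n).app ((mhsToFHS n).obj H)) := by
  rw [dropConnι_app_mhsToFHS]
  exact IsIso.id _

theorem isIso_kerProjι_app_vecToFHS (V : VecDiag.{u} n) :
    IsIso ((FHS.kerProjι n).app ((vecToFHS n).obj V)) := by
  rw [← map_vecToFHSCompKerProj]
  infer_instance

theorem kerProj_comp_vecToFHS_exact :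
    PreservesFiniteLimits (FHS.kerProj.{u} n ⋙ vecToFHS n) ∧
      PreservesFiniteColimits (FHS.kerProj.{u} n ⋙ vecToFHS n) := by
  obtain ⟨_, _⟩ := FHS.kerProj_exact.{u} n
  obtain ⟨_, _⟩ := vecToFHS_exact.{u} n
  exact ⟨comp_preservesFiniteLimits _ _, comp_preservesFiniteColimits _ _⟩

end FormalHodge

theorem mainTheorem8 (n : ℕ) [NeZero n] :
    Nonempty (Abelian (FormalHodge.MHSLevel.{u} n)) ∧ Nonempty (Abelian (FormalHodge.FHS.{u} n)) ∧
    ∀ [Abelian (FormalHodge.MHSLevel.{u} n)] [Abelian (FormalHodge.FHS.{u} n)],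
      (∃ (_ : (FormalHodge.mhsToFHS.{u} n).Additive)
        (_ : PreservesFiniteLimits (FormalHodge.mhsToFHS.{u} n))
        (_ : PreservesFiniteColimits (FormalHodge.mhsToFHS.{u} n)),
        ∀ [HasDerivedCategory.{w₁} (FormalHodge.MHSLevel.{u} n)]
          [HasDerivedCategory.{w₂} (FormalHodge.FHS.{u} n)],
          (FormalHodge.mhsToFHS.{u} n).mapDerivedCategory.Full ∧
          (FormalHodge.mhsToFHS.{u} n).mapDerivedCategory.Faithful) ∧
      (∃ (_ : (FormalHodge.vecToFHS.{u} n).Additive)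
        (_ : PreservesFiniteLimits (FormalHodge.vecToFHS.{u} n))
        (_ : PreservesFiniteColimits (FormalHodge.vecToFHS.{u} n)),
        ∀ [HasDerivedCategory.{w₃} (FormalHodge.VecDiag.{u} n)]
          [HasDerivedCategory.{w₂} (FormalHodge.FHS.{u} n)],
          (FormalHodge.vecToFHS.{u} n).mapDerivedCategory.Full ∧
          (FormalHodge.vecToFHS.{u} n).mapDerivedCategory.Faithful) := by
  refine ⟨⟨FormalHodge.MHSLevel.instAbelian n⟩, ⟨FormalHodge.FHS.instAbelian n⟩, fun {_ _} => ⟨?_, ?_⟩⟩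
  -- Zigzag (H,V) ← (H_et, 0, V) → (H_et, H_ℂ/F): both arrows are identities on the image of MHS_n.
  · exact FormalHodge.exact_and_mapDerivedCategory_full_and_faithful
      (FormalHodge.mhsToFHS_exact n) (FormalHodge.FHS.etFunctor_exact n)
      (FormalHodge.FHS.dropConn_exact n) (FormalHodge.FHS.dropConnι n)
      (FormalHodge.FHS.dropConnProj n) (Iso.refl _)
      (FormalHodge.isIso_dropConnι_app_mhsToFHS n) fun H => by
        rw [FormalHodge.dropConnι_app_mhsToFHS, FormalHodge.dropConnProj_app_mhsToFHS]
        exact (Category.id_comp _).trans ((FormalHodge.mhsToFHS n).map_id H)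
  -- Here T = E ⋙ ι, so the right arrow is the identity and the zigzag reduces to the inclusion of
  -- (0, Ker π).
  · exact FormalHodge.exact_and_mapDerivedCategory_full_and_faithful
      (FormalHodge.vecToFHS_exact n) (FormalHodge.FHS.kerProj_exact n)
      (FormalHodge.kerProj_comp_vecToFHS_exact n) (FormalHodge.FHS.kerProjι n) (𝟙 _)
      (FormalHodge.FHS.vecToFHSCompKerProj n) (FormalHodge.isIso_kerProjι_app_vecToFHS n)
      fun V => (Category.id_comp _).trans (FormalHodge.map_vecToFHSCompKerProj n V)
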